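/- Let $d\ge 1$, $\chi\in(0,1)$, and let $\mathcal V=B(0,V_0)\subset\mathbb R^d$ be the centered ball with $|\mathcal V|=1$. Put $K(x,v)=1+\chi\,\mathrm{sign}(x\cdot v)$, $\langle x\rangle=(1+|x|^2)^{1/2}$, and consider the linear run-and-tumble equation on $\mathbb R^d\times\mathcal V$ $$\partial_t f=-v\cdot\nabla_x f+\int_{\mathcal V}\bigl(K(x,v')f(t,x,v')-K(x,v)f(t,x,v)\bigr)\,dv',\qquad f(0,\cdot)=f_0 .$$ For $\gamma>0$ let $m(x)=e^{\gamma\langle x\rangle}$ and $\|g\|_{L^1(m)}=\int_{\mathbb R^d\times\mathcal V}|g|\,m\,dx\,dv$. Solutions are weak (distributional) solutions $f\in C([0,T);L^1_{loc})\cap L^\infty(0,T;L^1(m))$ for every $T>0$, and $S_{\mathcal L}(t)f_0:=f(t)$ denotes the solution semigroup on $L^1(m)$. There exists $\gamma^*>0$, depending only on $d$ and $\chi$, such that for every $\gamma\in(0,\gamma^*)$ the following hold. (i) There exist a measurable weight $\widetilde m=\widetilde m(x,v)$, a number $\delta\in(0,1)$ with $$(1-\delta)\,e^{\gamma\langle x\rangle}\le\widetilde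 m(x,v)\le(1+\delta)\,e^{\gamma\langle x\rangle}\qquad\text{for all }(x,v)\in\mathbb R^d\times\mathcal V,$$ and a constant $C\in(0,\infty)$ such that for every $f_0\in L^1(m)$ the solution $f$ with initial datum $f_0$ satisfies $$\int_{\mathbb R^d\times\mathcal V}|f(t)|\,\widetilde m\,dx\,dv\le\max\Bigl(C\int_{\mathbb R^d\times\mathcal V}|f_0|\,dx\,dv,\ \int_{\mathbb R^d\times\mathcal V}|f_0|\,\widetilde m\,dx\,dv\Bigr)\qquad\text{for all }t\ge0 .$$ (ii) In particular, the semigroup $S_{\mathcal L}$ is bounded in $L^1(m)$: there is $M>0$ with $\|S_{\mathcal L}(t)f_0\|_{L^1(m)}\le M\|f_0\|_{L^1(m)}$ for all $f_0\in L^1(m)$ and $t\ge0$. -/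

import Mathlib

open MeasureTheory Set Filter Topology
open scoped ContDiff

namespace RunTumble

/-- The position (and ambient velocity) space `ℝ^d` with its Euclidean norm. -/
abbrev Space (d : ℕ) : Type := EuclideanSpace ℝ (Fin d)

/-- The Japanese bracket `⟨x⟩ = (1 + |x|²)^{1/2}`. -/
noncomputable def bracket {d : ℕ} (x : Space d) : ℝ := Real.sqrt (1 + ‖x‖ ^ 2)

/-- The exponential weight `m(x) = exp (γ ⟨x⟩)`. -/
noncomputable def expWeight {d : ℕ} (γ : ℝ) (x : Space d) : ℝ := Real.exp (γ * bracket x)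

/-- The velocity set `𝒱 = B(0, V₀)`. -/
def velocities (d : ℕ) (V₀ : ℝ) : Set (Space d) := Metric.ball 0 V₀

/-- The measure `dx dv` on the phase space `ℝ^d × 𝒱`, seen as a measure on `ℝ^d × ℝ^d`. -/
noncomputable def phaseMeasure (d : ℕ) (V₀ : ℝ) : Measure (Space d × Space d) :=
  (volume : Measure (Space d)).prod (volume.restrict (velocities d V₀))

/-- The turning kernel `K(x, v) = 1 + χ sign (x · v)`. -/
noncomputable def turningKernel {d : ℕ} (χ : ℝ) (x v : Space d) : ℝ :=
  1 + χ * Real.sign (inner ℝ x v)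

/-- The dual operator `(ℒ* φ)(x, v) = v · ∇ₓ φ + K(x, v) ∫_𝒱 (φ(x, v') - φ(x, v)) dv'`,
for a differentiable `φ`; `v · ∇ₓ φ` is the derivative of `φ` in the direction `(v, 0)`. -/
noncomputable def dualOperator {d : ℕ} (χ V₀ : ℝ) (φ : Space d × Space d → ℝ)
    (z : Space d × Space d) : ℝ :=
  fderiv ℝ φ z (z.2, 0) +
    turningKernel χ z.1 z.2 * ∫ v' in velocities d V₀, (φ (z.1, v') - φ z)

/-- Membership in `L¹(m)` on `ℝ^d × 𝒱`, with `m = exp (γ ⟨x⟩)`. -/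
def MemL1Weight {d : ℕ} (V₀ γ : ℝ) (g : Space d × Space d → ℝ) : Prop :=
  AEStronglyMeasurable g (phaseMeasure d V₀) ∧
    Integrable (fun z => expWeight γ z.1 * g z) (phaseMeasure d V₀)

/-- The norm `‖g‖_{L¹(m)} = ∫ |g| m dx dv` (meaningful for `g ∈ L¹(m)`). -/
noncomputable def normL1Weight {d : ℕ} (V₀ γ : ℝ) (g : Space d × Space d → ℝ) : ℝ :=
  ∫ z, |g z| * expWeight γ z.1 ∂(phaseMeasure d V₀)

/-- Test functions: smooth functions with compact support in `ℝ^d × 𝒱`. -/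
structure IsTestFunction {d : ℕ} (V₀ : ℝ) (φ : Space d × Space d → ℝ) : Prop where
  smooth : ContDiff ℝ ∞ φ
  compactSupport : HasCompactSupport φ
  support_subset : tsupport φ ⊆ univ ×ˢ velocities d V₀

/-- `f = f(t, x, v)` is a weak (distributional) solution of
`∂ₜ f = - v · ∇ₓ f + ∫_𝒱 (K(x, v') f(t, x, v') - K(x, v) f(t, x, v)) dv'`, `f(0) = f₀`,
in the class `C([0, T); L¹_loc) ∩ L^∞(0, T; L¹(m))` for every `T > 0`. -/
structure IsWeakSolution {d : ℕ} (χ V₀ γ : ℝ) (f₀ : Space d × Space d → ℝ)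
    (f : ℝ → Space d × Space d → ℝ) : Prop where
  mem : ∀ t, 0 ≤ t → MemL1Weight V₀ γ (f t)
  locallyBounded : ∀ T, 0 < T → ∃ M, ∀ t ∈ Ico 0 T, normL1Weight V₀ γ (f t) ≤ M
  continuous_L1loc : ∀ Q : Set (Space d × Space d), IsCompact Q → Q ⊆ univ ×ˢ velocities d V₀ →
    ∀ t, 0 ≤ t →
      Tendsto (fun s => ∫ z in Q, |f s z - f t z| ∂(phaseMeasure d V₀)) (𝓝[Ici 0] t) (𝓝 0)
  weak_eq : ∀ φ : Space d × Space d → ℝ, IsTestFunction V₀ φ → ∀ t, 0 ≤ t →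
    ∫ z, f t z * φ z ∂(phaseMeasure d V₀) =
      (∫ z, f₀ z * φ z ∂(phaseMeasure d V₀)) +
        ∫ s in (0 : ℝ)..t, ∫ z, f s z * dualOperator χ V₀ φ z ∂(phaseMeasure d V₀)

open Classical in
/-- The solution semigroup `S_ℒ` of `L¹(m)`: `S_ℒ(t) f₀ = f(t)`, where `f` is the solution
with initial datum `f₀` (unique up to null sets at each time). -/
noncomputable def solutionSemigroup {d : ℕ} (χ V₀ γ : ℝ) (t : ℝ)
    (f₀ : Space d × Space d → ℝ) : Space d × Space d → ℝ :=
  if h : ∃ f, IsWeakSolution χ V₀ γ f₀ f then h.choose t else 0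

end RunTumble

/-! Write a = x·v/⟨x⟩ and take the weight p = e^{γ⟨x⟩}(1 + γa − γβa²). In ℒ*p, divided by γe^{γ⟨x⟩},
transport of the exponential produces a, while tumbling of the linear correction produces −Ka = −a −
χ|a|. The two a's cancel, leaving −χ|a|, which is useless only near a = 0. The quadratic correction
repairs this: its velocity average contributes −Kβκ(1 − ⟨x⟩⁻²), where ∫(x·v)² dv = κ|x|², and its
price Kβa² is absorbed by χ|a| for the right β. The remaining terms are O(γ) + O(1/⟨x⟩), so for
small γ one gets the Lyapunov inequality ℒ*p ≤ B − αp (`exists_lyapunov`). Formally d/dt ∫|f|p ≤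
B∫|f| − α∫|f|p; since the mass ∫|f| does not increase, ∫|f|p never exceeds the larger of (B/α)∫|f₀|
and its initial value.

The solutions are only weak, so the formal computation for |f| is replaced by duality. By
`integral_abs_mul_le_of_forall_isTestFunction`, ∫|f(h)|p is controlled by the pairings ∫f(h)φ with
test functions |φ| ≤ p. Moving φ backwards along the free flow removes transport and leaves only
tumbling (`IsWeakFlow.integral_freeFlow_le`). As K ≤ 2, the operator tumble + 2 is positive, hence
|tumble φ + 2φ| ≤ tumble p + 2p, up to the effect of the transport. This gives one time step with
error O(h²), uniformly in φ (`exists_integral_abs_mul_step`). Summing over ever finer partitions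
makes the quadratic errors vanish, even though their constants involve a norm bound on the time
interval considered; the final bound is therefore uniform in time. -/

namespace RunTumble

/-! ### One-variable tools -/

/-- A function whose increments are at most `A (b - a)` up to second order grows at most by `A T`. -/
theorem le_add_mul_of_increment_le {G : ℝ → ℝ} {T h₀ A C : ℝ} (hT : 0 ≤ T) (hh₀ : 0 < h₀)
    (hG : ∀ a b, 0 ≤ a → a ≤ b → b ≤ T → b - a ≤ h₀ →
      G b ≤ G a + A * (b - a) + C * (b - a) ^ 2) :
    G T ≤ G 0 + A * T := by
  have key : ∀ n : ℕ, 0 < n → T / n ≤ h₀ → ∀ k : ℕ, k ≤ n →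
      G (k * (T / n)) ≤ G 0 + k * (A * (T / n) + C * (T / n) ^ 2) := by
    intro n hn hnh k
    have hn' : (0 : ℝ) < n := by exact_mod_cast hn
    induction k with
    | zero => intro _; simp
    | succ k ih =>
      intro hk
      have h1 := ih (by omega)
      have hk' : ((k : ℝ) + 1) ≤ n := by exact_mod_cast hk
      have h0 : 0 ≤ T / n := by positivity
      have h2 := hG (k * (T / n)) ((k + 1) * (T / n)) (by positivity) (by nlinarith)
        (by
          calc ((k : ℝ) + 1) * (T / n) ≤ n * (T / n) := by gcongr
            _ = T := by field_simp)
        (by linarith)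
      have h3 : ((k : ℝ) + 1) * (T / n) - k * (T / n) = T / n := by ring
      rw [h3] at h2
      push_cast
      linarith
  -- With n equal steps the quadratic errors add up to n · C(T/n)² = CT²/n, which tends to 0
  -- whatever C is.
  have hlim : Tendsto (fun n : ℕ => G 0 + (A * T + C * T ^ 2 * (1 / (n : ℝ)))) atTop
      (𝓝 (G 0 + (A * T + C * T ^ 2 * 0))) :=
    tendsto_const_nhds.add (tendsto_const_nhds.add
      (tendsto_one_div_atTop_nhds_zero_nat.const_mul _))
  have hev : ∀ᶠ n : ℕ in atTop, G T ≤ G 0 + (A * T + C * T ^ 2 * (1 / (n : ℝ))) := by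
    have hsmall : ∀ᶠ n : ℕ in atTop, T / (n : ℝ) < h₀ :=
      (tendsto_const_div_atTop_nhds_zero_nat T).eventually (gt_mem_nhds hh₀)
    filter_upwards [hsmall, eventually_gt_atTop 0] with n h1 h2
    have h3 := key n h2 h1.le n le_rfl
    have hn' : (n : ℝ) ≠ 0 := by positivity
    have h4 : (n : ℝ) * (T / n) = T := by field_simp
    rw [h4] at h3
    have h5 : (n : ℝ) * (A * (T / n) + C * (T / n) ^ 2) = A * T + C * T ^ 2 * (1 / n) := by
      field_simp
    linarith
  have := ge_of_tendsto hlim hev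
  linarith

/-- The mean value inequality on `[a, b]` for a function with derivative bounded by `C`. -/
theorem abs_sub_le_of_hasDerivAt {g g' : ℝ → ℝ} {a b C : ℝ} (hab : a ≤ b)
    (hg : ∀ r, HasDerivAt g (g' r) r) (hC : ∀ r ∈ Icc a b, |g' r| ≤ C) :
    |g b - g a| ≤ C * (b - a) :=
  norm_image_sub_le_of_norm_deriv_le_segment' (f := g) (f' := g') (a := a) (b := b) (C := C)
    (fun x _ => (hg x).hasDerivWithinAt) (fun x hx => hC x (Ico_subset_Icc_self hx)) b
    (right_mem_Icc.2 hab)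

/-- First-order Taylor bound from the left endpoint. -/
theorem abs_sub_sub_le_of_hasDerivAt {g g' g'' : ℝ → ℝ} {a b C : ℝ} (hab : a ≤ b)
    (hg : ∀ r, HasDerivAt g (g' r) r) (hg' : ∀ r, HasDerivAt g' (g'' r) r)
    (hC : ∀ r ∈ Icc a b, |g'' r| ≤ C) :
    |g b - g a - (b - a) * g' a| ≤ C * (b - a) ^ 2 := by
  have hC0 : 0 ≤ C := (abs_nonneg _).trans (hC a (left_mem_Icc.2 hab))
  have h1 : ∀ r ∈ Icc a b, |g' r - g' a| ≤ C * (b - a) := fun r hr =>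
    (abs_sub_le_of_hasDerivAt hr.1 hg' fun s hs => hC s ⟨hs.1, hs.2.trans hr.2⟩).trans
      (by gcongr; exact hr.2)
  have h2 := abs_sub_le_of_hasDerivAt (g := fun r => g r - (r - a) * g' a)
    (g' := fun r => g' r - g' a) hab
    (fun r => by
      have := (hg r).fun_sub (((hasDerivAt_id' r).sub_const a).mul_const (g' a))
      rwa [one_mul] at this) h1
  have h3 : (g b - (b - a) * g' a) - (g a - (a - a) * g' a) = g b - g a - (b - a) * g' a := by ring
  rw [h3] at h2
  linarith [h2, sq (b - a), mul_assoc C (b - a) (b - a)]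

/-! ### Free transport and the stream derivative -/

variable {d : ℕ}

/-- Composition with the free flow `(x, v) ↦ (x + τ v, v)`. -/
def freeFlow (τ : ℝ) (φ : Space d × Space d → ℝ) (z : Space d × Space d) : ℝ :=
  φ (z.1 + τ • z.2, z.2)

/-- The derivative `v · ∇ₓ φ` along the free flow. -/
noncomputable def streamDeriv (φ : Space d × Space d → ℝ) (z : Space d × Space d) : ℝ :=
  fderiv ℝ φ z (z.2, 0)

/-- The free flow as a homeomorphism of phase space. -/
def freeFlowHomeomorph (τ : ℝ) : Space d × Space d ≃ₜ Space d × Space d where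
  toFun z := (z.1 + τ • z.2, z.2)
  invFun z := (z.1 - τ • z.2, z.2)
  left_inv z := by simp
  right_inv z := by simp
  continuous_toFun := by fun_prop
  continuous_invFun := by fun_prop

theorem freeFlow_freeFlow (σ τ : ℝ) (φ : Space d × Space d → ℝ) :
    freeFlow σ (freeFlow τ φ) = freeFlow (σ + τ) φ := by
  funext z
  simp only [freeFlow, add_assoc, add_smul]

theorem freeFlow_zero (φ : Space d × Space d → ℝ) : freeFlow 0 φ = φ := by
  funext z
  simp [freeFlow]

theorem hasDerivAt_freeFlow {φ : Space d × Space d → ℝ} (hφ : Differentiable ℝ φ)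
    (z : Space d × Space d) (τ : ℝ) :
    HasDerivAt (fun r => freeFlow r φ z) (freeFlow τ (streamDeriv φ) z) τ := by
  have h1 : HasDerivAt (fun r : ℝ => (z.1 + r • z.2, z.2)) (z.2, (0 : Space d)) τ := by
    have h2 : HasDerivAt (fun r : ℝ => z.1 + r • z.2) z.2 τ := by
      simpa using ((hasDerivAt_id τ).smul_const z.2).const_add z.1
    exact h2.prodMk (hasDerivAt_const τ z.2)
  exact (hφ (z.1 + τ • z.2, z.2)).hasFDerivAt.comp_hasDerivAt τ h1

theorem streamDeriv_eq_of_hasDerivAt {φ : Space d × Space d → ℝ} (hφ : Differentiable ℝ φ)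
    {z : Space d × Space d} {c : ℝ} (h : HasDerivAt (fun r => freeFlow r φ z) c 0) :
    streamDeriv φ z = c := by
  have h1 := (hasDerivAt_freeFlow hφ z 0).unique h
  rwa [freeFlow_zero] at h1

theorem contDiff_freeFlow {φ : Space d × Space d → ℝ} (hφ : ContDiff ℝ ∞ φ) (τ : ℝ) :
    ContDiff ℝ ∞ (freeFlow τ φ) := by
  unfold freeFlow
  exact hφ.comp (by fun_prop)

theorem contDiff_streamDeriv {φ : Space d × Space d → ℝ} (hφ : ContDiff ℝ ∞ φ) :
    ContDiff ℝ ∞ (streamDeriv φ) := by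
  have h1 : ContDiff ℝ ∞ (fderiv ℝ φ) := hφ.fderiv_right (by norm_cast)
  unfold streamDeriv
  exact h1.clm_apply (by fun_prop)

theorem differentiable_of_contDiff_infty {φ : Space d × Space d → ℝ} (hφ : ContDiff ℝ ∞ φ) :
    Differentiable ℝ φ := hφ.differentiable (by norm_cast)

theorem streamDeriv_freeFlow {φ : Space d × Space d → ℝ} (hφ : ContDiff ℝ ∞ φ) (τ : ℝ) :
    streamDeriv (freeFlow τ φ) = freeFlow τ (streamDeriv φ) := by
  funext z
  apply streamDeriv_eq_of_hasDerivAt (differentiable_of_contDiff_infty (contDiff_freeFlow hφ τ))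
  have h2 : (fun r => freeFlow r (freeFlow τ φ) z) = fun r => freeFlow (r + τ) φ z := by
    funext r
    rw [freeFlow_freeFlow]
  rw [h2]
  refine HasDerivAt.comp_add_const (f := fun r => freeFlow r φ z) 0 τ ?_
  rw [zero_add]
  exact hasDerivAt_freeFlow (differentiable_of_contDiff_infty hφ) z τ

/-! ### Stability of test functions under transport and stream differentiation. -/

namespace IsTestFunction

variable {V₀ : ℝ} {φ : Space d × Space d → ℝ}

theorem neg (hφ : IsTestFunction V₀ φ) : IsTestFunction V₀ (fun z => -φ z) where
  smooth := hφ.smooth.neg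
  compactSupport := by
    have := hφ.compactSupport
    exact this.neg
  support_subset := by
    have h : tsupport (fun z => -φ z) = tsupport φ := by
      simp [tsupport, Function.support_fun_neg]
    rw [h]
    exact hφ.support_subset

theorem of_tsupport_subset {ψ : Space d × Space d → ℝ} (hφ : IsTestFunction V₀ φ)
    (hψ : ContDiff ℝ ∞ ψ) (h : tsupport ψ ⊆ tsupport φ) : IsTestFunction V₀ ψ where
  smooth := hψ
  compactSupport := hφ.compactSupport.of_isClosed_subset (isClosed_tsupport _) h
  support_subset := h.trans hφ.support_subset

theorem streamDeriv (hφ : IsTestFunction V₀ φ) : IsTestFunction V₀ (streamDeriv φ) := by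
  refine hφ.of_tsupport_subset (contDiff_streamDeriv hφ.smooth) ?_
  refine closure_minimal (fun z hz => ?_) (isClosed_tsupport _)
  by_contra h
  apply hz
  have : fderiv ℝ φ z = 0 := by
    by_contra h2
    exact h (support_fderiv_subset ℝ h2)
  simp [RunTumble.streamDeriv, this]

/-- The flow keeps v fixed, so the velocity support stays inside the open ball and transported
functions remain admissible in the weak equation. -/
theorem freeFlow (hφ : IsTestFunction V₀ φ) (τ : ℝ) : IsTestFunction V₀ (freeFlow τ φ) where
  smooth := contDiff_freeFlow hφ.smooth τ
  compactSupport := hφ.compactSupport.comp_homeomorph (freeFlowHomeomorph τ)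
  support_subset := by
    have h : tsupport (RunTumble.freeFlow τ φ) = freeFlowHomeomorph τ ⁻¹' tsupport φ :=
      tsupport_comp_eq_preimage φ (freeFlowHomeomorph τ)
    rw [h]
    intro z hz
    exact ⟨mem_univ _, (hφ.support_subset (show freeFlowHomeomorph τ z ∈ tsupport φ from hz)).2⟩

theorem exists_bound (hφ : IsTestFunction V₀ φ) : ∃ C, 0 ≤ C ∧ ∀ z, |φ z| ≤ C := by
  obtain ⟨C, hC⟩ := hφ.compactSupport.exists_bound_of_continuous hφ.smooth.continuous
  exact ⟨C, (norm_nonneg _).trans (hC 0), hC⟩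

theorem differentiable (hφ : IsTestFunction V₀ φ) : Differentiable ℝ φ :=
  differentiable_of_contDiff_infty hφ.smooth

end IsTestFunction

end RunTumble

namespace RunTumble

variable {d : ℕ}

/-! ### The bracket and the exponential weight -/

theorem one_le_bracket (x : Space d) : 1 ≤ bracket x := by
  unfold bracket
  rw [Real.one_le_sqrt]
  nlinarith [sq_nonneg ‖x‖]

theorem bracket_sq (x : Space d) : bracket x ^ 2 = 1 + ‖x‖ ^ 2 :=
  Real.sq_sqrt (by positivity)

theorem norm_le_bracket (x : Space d) : ‖x‖ ≤ bracket x := by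
  apply Real.le_sqrt_of_sq_le
  linarith

theorem bracket_add_le (x y : Space d) : bracket (x + y) ≤ bracket x + ‖y‖ := by
  have h1 := one_le_bracket x
  apply Real.sqrt_le_iff.2 ⟨by positivity, ?_⟩
  have h2 := norm_add_le x y
  have h3 := bracket_sq x
  have h4 := norm_le_bracket x
  have h5 : ‖x + y‖ ^ 2 ≤ (‖x‖ + ‖y‖) ^ 2 := by gcongr
  nlinarith [mul_le_mul_of_nonneg_right h4 (norm_nonneg y)]

theorem contDiff_bracket : ContDiff ℝ ∞ (bracket : Space d → ℝ) := by
  unfold bracket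
  apply ContDiff.sqrt
  · exact contDiff_const.add (contDiff_norm_sq ℝ)
  · intro x
    positivity

theorem expWeight_pos (γ : ℝ) (x : Space d) : 0 < expWeight γ x := Real.exp_pos _

theorem one_le_expWeight {γ : ℝ} (hγ : 0 ≤ γ) (x : Space d) : 1 ≤ expWeight γ x :=
  Real.one_le_exp (mul_nonneg hγ (zero_le_one.trans (one_le_bracket x)))

theorem contDiff_expWeight (γ : ℝ) : ContDiff ℝ ∞ (expWeight γ : Space d → ℝ) :=
  (contDiff_const.mul contDiff_bracket).exp

theorem expWeight_add_smul_le {γ V₀ τ : ℝ} (hγ : 0 ≤ γ) (hτ : 0 ≤ τ) (hτ1 : τ ≤ 1)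
    (x : Space d) {v : Space d} (hv : v ∈ velocities d V₀) :
    expWeight γ (x + τ • v) ≤ Real.exp (γ * V₀) * expWeight γ x := by
  have hv' : ‖v‖ < V₀ := by simpa [velocities] using hv
  have h1 : ‖τ • v‖ ≤ V₀ := by
    rw [norm_smul, Real.norm_of_nonneg hτ]
    nlinarith [norm_nonneg v]
  unfold expWeight
  rw [← Real.exp_add]
  apply Real.exp_le_exp.2
  nlinarith [bracket_add_le x (τ • v), mul_le_mul_of_nonneg_left (bracket_add_le x (τ • v)) hγ,
    mul_le_mul_of_nonneg_left h1 hγ]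

/-! ### The phase measure -/

theorem measurableSet_velocities (V₀ : ℝ) : MeasurableSet (velocities d V₀) :=
  Metric.isOpen_ball.measurableSet

theorem phaseMeasure_eq_restrict (V₀ : ℝ) :
    phaseMeasure d V₀ =
      (volume : Measure (Space d × Space d)).restrict (univ ×ˢ velocities d V₀) := by
  rw [phaseMeasure, Measure.volume_eq_prod, ← Measure.prod_restrict, Measure.restrict_univ]

theorem ae_mem_velocities (V₀ : ℝ) : ∀ᵐ z ∂(phaseMeasure d V₀), z.2 ∈ velocities d V₀ := by
  rw [phaseMeasure_eq_restrict]
  filter_upwards [ae_restrict_mem (MeasurableSet.univ.prod (measurableSet_velocities V₀))]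
    with z hz using hz.2

/-! ### Pairing with functions in the weighted space -/

section Pairing

variable {V₀ γ c : ℝ} {g ψ : Space d × Space d → ℝ}

theorem MemL1Weight.integrable_abs_mul (hg : MemL1Weight V₀ γ g) :
    Integrable (fun z => |g z| * expWeight γ z.1) (phaseMeasure d V₀) := by
  refine hg.2.abs.congr (ae_of_all _ fun z => ?_)
  simp only [abs_mul, abs_of_pos (expWeight_pos γ z.1), mul_comm]

theorem normL1Weight_nonneg (V₀ γ : ℝ) (g : Space d × Space d → ℝ) : 0 ≤ normL1Weight V₀ γ g :=
  integral_nonneg fun z => mul_nonneg (abs_nonneg _) (expWeight_pos γ z.1).le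

theorem MemL1Weight.abs (hg : MemL1Weight V₀ γ g) : MemL1Weight V₀ γ (fun z => |g z|) := by
  refine ⟨hg.1.norm, ?_⟩
  simpa only [mul_comm] using hg.integrable_abs_mul

theorem normL1Weight_abs (V₀ γ : ℝ) (g : Space d × Space d → ℝ) :
    normL1Weight V₀ γ (fun z => |g z|) = normL1Weight V₀ γ g := by
  simp only [normL1Weight, abs_abs]

theorem MemL1Weight.integrable_mul (hg : MemL1Weight V₀ γ g)
    (hψ : AEStronglyMeasurable ψ (phaseMeasure d V₀))
    (hc : ∀ z, z.2 ∈ velocities d V₀ → |ψ z| ≤ c * expWeight γ z.1) :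
    Integrable (fun z => g z * ψ z) (phaseMeasure d V₀) := by
  refine (hg.integrable_abs_mul.const_mul c).mono' (hg.1.mul hψ) ?_
  filter_upwards [ae_mem_velocities V₀] with z hz
  rw [Real.norm_eq_abs, abs_mul]
  nlinarith [mul_le_mul_of_nonneg_left (hc z hz) (abs_nonneg (g z))]

theorem MemL1Weight.abs_integral_mul_le (hg : MemL1Weight V₀ γ g)
    (hc : ∀ z, z.2 ∈ velocities d V₀ → |ψ z| ≤ c * expWeight γ z.1) :
    |∫ z, g z * ψ z ∂(phaseMeasure d V₀)| ≤ c * normL1Weight V₀ γ g := by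
  rw [normL1Weight, ← integral_const_mul, ← Real.norm_eq_abs]
  refine norm_integral_le_of_norm_le (hg.integrable_abs_mul.const_mul c) ?_
  filter_upwards [ae_mem_velocities V₀] with z hz
  rw [Real.norm_eq_abs, abs_mul]
  nlinarith [mul_le_mul_of_nonneg_left (hc z hz) (abs_nonneg (g z))]

theorem le_mul_expWeight_of_abs_le (hγ : 0 ≤ γ) (hc : ∀ z, |ψ z| ≤ c) (z : Space d × Space d) :
    |ψ z| ≤ c * expWeight γ z.1 :=
  (hc z).trans (le_mul_of_one_le_right ((abs_nonneg _).trans (hc z)) (one_le_expWeight hγ z.1))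

theorem MemL1Weight.integrable_mul_of_bounded (hγ : 0 ≤ γ) (hg : MemL1Weight V₀ γ g)
    (hψ : AEStronglyMeasurable ψ (phaseMeasure d V₀)) (hc : ∀ z, |ψ z| ≤ c) :
    Integrable (fun z => g z * ψ z) (phaseMeasure d V₀) :=
  hg.integrable_mul hψ fun z _ => le_mul_expWeight_of_abs_le hγ hc z

/-- Monotonicity: if `|ψ| ≤ w` on phase space then `∫ g ψ ≤ ∫ |g| w`. -/
theorem MemL1Weight.integral_mul_le {w : Space d × Space d → ℝ} (hg : MemL1Weight V₀ γ g)
    (hw : AEStronglyMeasurable w (phaseMeasure d V₀))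
    (hc : ∀ z, z.2 ∈ velocities d V₀ → |w z| ≤ c * expWeight γ z.1)
    (hψw : ∀ z, z.2 ∈ velocities d V₀ → |ψ z| ≤ w z) :
    ∫ z, g z * ψ z ∂(phaseMeasure d V₀) ≤ ∫ z, |g z| * w z ∂(phaseMeasure d V₀) := by
  refine (Real.le_norm_self _).trans
    (norm_integral_le_of_norm_le (hg.abs.integrable_mul hw hc) ?_)
  filter_upwards [ae_mem_velocities V₀] with z hz
  rw [Real.norm_eq_abs, abs_mul]
  exact mul_le_mul_of_nonneg_left (hψw z hz) (abs_nonneg _)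

/-- Comparison of weighted integrals of `|g|` up to a multiple of the weighted norm. -/
theorem MemL1Weight.integral_abs_mul_le_add {c' c'' : ℝ} {w w' : Space d × Space d → ℝ}
    (hg : MemL1Weight V₀ γ g)
    (hw : AEStronglyMeasurable w (phaseMeasure d V₀))
    (hwc : ∀ z, z.2 ∈ velocities d V₀ → |w z| ≤ c * expWeight γ z.1)
    (hw' : AEStronglyMeasurable w' (phaseMeasure d V₀))
    (hwc' : ∀ z, z.2 ∈ velocities d V₀ → |w' z| ≤ c' * expWeight γ z.1)
    (h : ∀ z, z.2 ∈ velocities d V₀ → w z ≤ w' z + c'' * expWeight γ z.1) :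
    ∫ z, |g z| * w z ∂(phaseMeasure d V₀) ≤
      ∫ z, |g z| * w' z ∂(phaseMeasure d V₀) + c'' * normL1Weight V₀ γ g := by
  have h1 := hg.abs.integrable_mul hw' hwc'
  have h2 := hg.integrable_abs_mul.const_mul c''
  rw [normL1Weight, ← integral_const_mul, ← integral_add h1 h2]
  refine integral_mono_ae (hg.abs.integrable_mul hw hwc) (h1.add h2) ?_
  filter_upwards [ae_mem_velocities V₀] with z hz
  have := mul_le_mul_of_nonneg_left (h z hz) (abs_nonneg (g z))
  linarith

end Pairing

/-! ### The tumbling part of the dual operator -/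

/-- The tumbling part `K(x, v) ∫_𝒱 (φ(x, v') - φ(x, v)) dv'` of the dual operator. -/
noncomputable def tumble (χ V₀ : ℝ) (φ : Space d × Space d → ℝ) (z : Space d × Space d) : ℝ :=
  turningKernel χ z.1 z.2 * ∫ v' in velocities d V₀, (φ (z.1, v') - φ z)

theorem dualOperator_eq (χ V₀ : ℝ) (φ : Space d × Space d → ℝ) (z : Space d × Space d) :
    dualOperator χ V₀ φ z = streamDeriv φ z + tumble χ V₀ φ z := rfl

section Tumble

variable {χ V₀ γ c : ℝ} {φ : Space d × Space d → ℝ}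

theorem turningKernel_bounds (hχ₀ : 0 < χ) (hχ₁ : χ < 1) (x v : Space d) :
    0 ≤ turningKernel χ x v ∧ turningKernel χ x v ≤ 2 := by
  unfold turningKernel
  rcases Real.sign_apply_eq (inner ℝ x v) with h | h | h <;> rw [h] <;> constructor <;> linarith

theorem measurable_turningKernel (χ : ℝ) :
    Measurable (fun z : Space d × Space d => turningKernel χ z.1 z.2) := by
  have h1 : Measurable Real.sign := by
    unfold Real.sign
    exact Measurable.ite measurableSet_Iio measurable_const
      (Measurable.ite measurableSet_Ioi measurable_const measurable_const)
  have h2 : Measurable (fun z : Space d × Space d => inner ℝ z.1 z.2) :=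
    (continuous_fst.inner continuous_snd).measurable
  exact ((h1.comp h2).const_mul χ).const_add 1

theorem measurable_tumble (χ V₀ : ℝ) (hφ : Continuous φ) : Measurable (tumble χ V₀ φ) := by
  refine (measurable_turningKernel χ).mul ?_
  have h1 : Continuous (fun p : (Space d × Space d) × Space d => φ (p.1.1, p.2) - φ p.1) := by
    fun_prop
  exact (h1.stronglyMeasurable.integral_prod_right
    (ν := volume.restrict (velocities d V₀))).measurable

theorem abs_tumble_le (hV : volume (velocities d V₀) = 1) (hχ₀ : 0 < χ) (hχ₁ : χ < 1) {z : Space d × Space d} {B : ℝ}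
    (hB : ∀ v ∈ velocities d V₀, |φ (z.1, v)| ≤ B) (hB0 : |φ z| ≤ B) :
    |tumble χ V₀ φ z| ≤ 4 * B := by
  have h1 : ‖∫ v' in velocities d V₀, (φ (z.1, v') - φ z)‖ ≤
      2 * B * volume.real (velocities d V₀) := by
    apply norm_setIntegral_le_of_norm_le_const (by simp [hV])
    intro v hv
    have := abs_sub (φ (z.1, v)) (φ z)
    rw [Real.norm_eq_abs]
    linarith [hB v hv]
  have h2 : volume.real (velocities d V₀) = 1 := by simp [Measure.real, hV]
  rw [h2, mul_one, Real.norm_eq_abs] at h1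
  -- The factor 4 is 2 from the kernel times 2 from the difference of two values.
  obtain ⟨h3, h4⟩ := turningKernel_bounds hχ₀ hχ₁ z.1 z.2
  rw [tumble, abs_mul, abs_of_nonneg h3]
  nlinarith [abs_nonneg (∫ v' in velocities d V₀, (φ (z.1, v') - φ z))]

end Tumble

end RunTumble

namespace RunTumble

variable {d : ℕ} {χ V₀ γ : ℝ}

/-! ### The weak equation between two arbitrary times -/

/-- The consequences of `IsWeakSolution` used below: the weak equation between any two times.
Unlike `IsWeakSolution` it does not mention the initial datum, and it is invariant under
time shifts. -/
structure IsWeakFlow (χ V₀ γ : ℝ) (f : ℝ → Space d × Space d → ℝ) : Prop where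
  mem : ∀ t, 0 ≤ t → MemL1Weight V₀ γ (f t)
  intervalIntegrable : ∀ φ, IsTestFunction V₀ φ → ∀ a b, 0 ≤ a → 0 ≤ b →
    IntervalIntegrable (fun s => ∫ z, f s z * dualOperator χ V₀ φ z ∂(phaseMeasure d V₀))
      volume a b
  integral_sub : ∀ φ, IsTestFunction V₀ φ → ∀ a b, 0 ≤ a → a ≤ b →
    ∫ z, f b z * φ z ∂(phaseMeasure d V₀) - ∫ z, f a z * φ z ∂(phaseMeasure d V₀) =
      ∫ s in a..b, ∫ z, f s z * dualOperator χ V₀ φ z ∂(phaseMeasure d V₀)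

theorem IsWeakFlow.shift {f : ℝ → Space d × Space d → ℝ} (hf : IsWeakFlow χ V₀ γ f) {s : ℝ}
    (hs : 0 ≤ s) : IsWeakFlow χ V₀ γ (fun t => f (s + t)) where
  mem t ht := hf.mem _ (by linarith)
  intervalIntegrable φ hφ a b ha hb := by
    have := (hf.intervalIntegrable φ hφ (s + a) (s + b) (by linarith) (by linarith)).comp_add_left s
    simpa using this
  integral_sub φ hφ a b ha hab := by
    rw [hf.integral_sub φ hφ (s + a) (s + b) (by linarith) (by linarith)]
    exact (intervalIntegral.integral_comp_add_left (a := a) (b := b)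
      (fun s => ∫ z, f s z * dualOperator χ V₀ φ z ∂(phaseMeasure d V₀)) s).symm

/-- A compact exhaustion of the phase space `ℝ^d × 𝒱`. -/
def phaseExhaustion (d : ℕ) (V₀ : ℝ) (n : ℕ) : Set (Space d × Space d) :=
  Metric.closedBall 0 n ×ˢ Metric.closedBall 0 (V₀ - 1 / ((n : ℝ) + 1))

theorem isCompact_phaseExhaustion (n : ℕ) : IsCompact (phaseExhaustion d V₀ n) :=
  (isCompact_closedBall _ _).prod (isCompact_closedBall _ _)

theorem phaseExhaustion_subset (n : ℕ) :
    phaseExhaustion d V₀ n ⊆ univ ×ˢ velocities d V₀ := by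
  rintro z ⟨-, hz⟩
  refine ⟨mem_univ _, Metric.closedBall_subset_ball ?_ hz⟩
  have : 0 < 1 / ((n : ℝ) + 1) := by positivity
  linarith

theorem monotone_phaseExhaustion : Monotone (phaseExhaustion d V₀) := by
  intro n k hnk
  have h : (n : ℝ) ≤ k := by exact_mod_cast hnk
  refine prod_mono (Metric.closedBall_subset_closedBall h) (Metric.closedBall_subset_closedBall ?_)
  have : 1 / ((k : ℝ) + 1) ≤ 1 / ((n : ℝ) + 1) := by gcongr
  linarith

theorem iUnion_phaseExhaustion : ⋃ n, phaseExhaustion d V₀ n = univ ×ˢ velocities d V₀ := by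
  refine Subset.antisymm (iUnion_subset phaseExhaustion_subset) ?_
  rintro z ⟨-, hz⟩
  have hz' : ‖z.2‖ < V₀ := by simpa [velocities] using hz
  obtain ⟨n, hn⟩ := exists_nat_ge ‖z.1‖
  obtain ⟨k, hk⟩ := exists_nat_one_div_lt (sub_pos.2 hz')
  refine mem_iUnion.2 ⟨max n k, ?_, ?_⟩
  · rw [mem_closedBall_zero_iff]
    exact hn.trans (by exact_mod_cast le_max_left n k)
  · rw [mem_closedBall_zero_iff]
    have h1 : (k : ℝ) ≤ (max n k : ℕ) := by exact_mod_cast le_max_right n k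
    have h2 : 1 / (((max n k : ℕ) : ℝ) + 1) ≤ 1 / ((k : ℝ) + 1) := by gcongr
    linarith

section WeakSolution

variable {f₀ : Space d × Space d → ℝ} {f : ℝ → Space d × Space d → ℝ}

theorem IsWeakSolution.continuousOn_setIntegral (hf : IsWeakSolution χ V₀ γ f₀ f) (hγ : 0 ≤ γ)
    {ψ : Space d × Space d → ℝ} {c : ℝ} (hψ : AEStronglyMeasurable ψ (phaseMeasure d V₀))
    (hc : ∀ z, |ψ z| ≤ c) {Q : Set (Space d × Space d)} (hQ : IsCompact Q)
    (hQV : Q ⊆ univ ×ˢ velocities d V₀) :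
    ContinuousOn (fun s => ∫ z in Q, f s z * ψ z ∂(phaseMeasure d V₀)) (Ici 0) := by
  intro t ht
  have hint : ∀ s, 0 ≤ s → Integrable (f s) (phaseMeasure d V₀) := by
    intro s hs
    have := (hf.mem s hs).integrable_mul_of_bounded hγ (ψ := fun _ => 1) (c := 1)
      aestronglyMeasurable_const (by simp)
    simpa using this
  have h0 := (hf.continuous_L1loc Q hQ hQV t ht).const_mul c
  rw [mul_zero] at h0
  refine tendsto_iff_dist_tendsto_zero.2 (squeeze_zero' (Eventually.of_forall fun _ => dist_nonneg)
    ?_ h0)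
  filter_upwards [self_mem_nhdsWithin] with s hs
  have h1 := (hf.mem s hs).integrable_mul_of_bounded hγ hψ hc
  have h2 := (hf.mem t ht).integrable_mul_of_bounded hγ hψ hc
  rw [Real.dist_eq, ← integral_sub h1.integrableOn h2.integrableOn, ← integral_const_mul,
    ← Real.norm_eq_abs]
  refine norm_integral_le_of_norm_le
    ((((hint s hs).sub (hint t ht)).abs.const_mul c).integrableOn) (ae_of_all _ fun z => ?_)
  rw [Real.norm_eq_abs, ← sub_mul, abs_mul, mul_comm]
  exact mul_le_mul_of_nonneg_right (hc z) (abs_nonneg _)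

/-- Continuity in time is known only in L¹ on compact subsets of phase space. The pairing is
therefore a pointwise limit of continuous functions along a compact exhaustion, hence measurable in
time; the local bound on the weighted norm then gives integrability. -/
theorem IsWeakSolution.intervalIntegrable_integral_mul (hf : IsWeakSolution χ V₀ γ f₀ f)
    (hγ : 0 ≤ γ) {ψ : Space d × Space d → ℝ} {c : ℝ}
    (hψ : AEStronglyMeasurable ψ (phaseMeasure d V₀)) (hc : ∀ z, |ψ z| ≤ c) {a b : ℝ}
    (ha : 0 ≤ a) (hb : 0 ≤ b) :
    IntervalIntegrable (fun s => ∫ z, f s z * ψ z ∂(phaseMeasure d V₀)) volume a b := by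
  have hmeas : AEStronglyMeasurable (fun s => ∫ z, f s z * ψ z ∂(phaseMeasure d V₀))
      (volume.restrict (Ici 0)) := by
    refine aestronglyMeasurable_of_tendsto_ae atTop
      (f := fun n s => ∫ z in phaseExhaustion d V₀ n, f s z * ψ z ∂(phaseMeasure d V₀))
      (fun n => (hf.continuousOn_setIntegral hγ hψ hc (isCompact_phaseExhaustion n)
        (phaseExhaustion_subset n)).aestronglyMeasurable measurableSet_Ici) ?_
    filter_upwards [ae_restrict_mem measurableSet_Ici] with s hs
    have h1 := (hf.mem s hs).integrable_mul_of_bounded hγ hψ hc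
    have h2 := tendsto_setIntegral_of_monotone
      (fun n => (isCompact_phaseExhaustion (d := d) (V₀ := V₀) n).measurableSet)
      monotone_phaseExhaustion h1.integrableOn
    rw [iUnion_phaseExhaustion] at h2
    have h3 : (phaseMeasure d V₀).restrict (univ ×ˢ velocities d V₀) = phaseMeasure d V₀ := by
      rw [phaseMeasure_eq_restrict,
        Measure.restrict_restrict (MeasurableSet.univ.prod (measurableSet_velocities V₀)), inter_self]
    rwa [h3] at h2
  obtain ⟨M, hM⟩ := hf.locallyBounded (max a b + 1) (by positivity)
  have hc0 : 0 ≤ c := (abs_nonneg _).trans (hc 0)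
  have hsub : uIoc a b ⊆ Ici 0 := fun s hs => (le_min ha hb).trans hs.1.le
  rw [intervalIntegrable_iff]
  refine IntegrableOn.of_bound (by simp [uIoc]) (hmeas.mono_set hsub) (c * M) ?_
  filter_upwards [ae_restrict_mem measurableSet_uIoc] with s hs
  have hs0 : 0 ≤ s := hsub hs
  rw [Real.norm_eq_abs]
  refine ((hf.mem s hs0).abs_integral_mul_le
    (fun z _ => le_mul_expWeight_of_abs_le hγ hc z)).trans ?_
  exact mul_le_mul_of_nonneg_left (hM s ⟨hs0, by linarith [hs.2]⟩) hc0

theorem exists_bound_dualOperator (hV : volume (velocities d V₀) = 1) (hχ₀ : 0 < χ) (hχ₁ : χ < 1)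
    {φ : Space d × Space d → ℝ} (hφ : IsTestFunction V₀ φ) :
    ∃ c, ∀ z, |dualOperator χ V₀ φ z| ≤ c := by
  obtain ⟨B, -, hB⟩ := hφ.exists_bound
  obtain ⟨B', -, hB'⟩ := hφ.streamDeriv.exists_bound
  refine ⟨B' + 4 * B, fun z => ?_⟩
  rw [dualOperator_eq]
  exact (abs_add_le _ _).trans
    (add_le_add (hB' z) (abs_tumble_le hV hχ₀ hχ₁ (fun v _ => hB _) (hB z)))

theorem measurable_dualOperator {φ : Space d × Space d → ℝ} (hφ : IsTestFunction V₀ φ) :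
    Measurable (dualOperator χ V₀ φ) :=
  hφ.streamDeriv.smooth.continuous.measurable.add (measurable_tumble χ V₀ hφ.smooth.continuous)

theorem IsWeakSolution.isWeakFlow (hf : IsWeakSolution χ V₀ γ f₀ f) (hγ : 0 ≤ γ)
    (hV : volume (velocities d V₀) = 1) (hχ₀ : 0 < χ) (hχ₁ : χ < 1) : IsWeakFlow χ V₀ γ f where
  mem := hf.mem
  intervalIntegrable φ hφ a b ha hb := by
    obtain ⟨c, hc⟩ := exists_bound_dualOperator hV hχ₀ hχ₁ hφ
    exact hf.intervalIntegrable_integral_mul hγ (measurable_dualOperator hφ).aestronglyMeasurable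
      hc ha hb
  integral_sub φ hφ a b ha hab := by
    obtain ⟨c, hc⟩ := exists_bound_dualOperator hV hχ₀ hχ₁ hφ
    have hi : ∀ t, 0 ≤ t → IntervalIntegrable
        (fun s => ∫ z, f s z * dualOperator χ V₀ φ z ∂(phaseMeasure d V₀)) volume 0 t :=
      fun t ht => hf.intervalIntegrable_integral_mul hγ
        (measurable_dualOperator hφ).aestronglyMeasurable hc le_rfl ht
    rw [hf.weak_eq φ hφ a ha, hf.weak_eq φ hφ b (ha.trans hab),
      ← intervalIntegral.integral_interval_sub_left (hi b (ha.trans hab)) (hi a ha)]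
    ring

end WeakSolution

end RunTumble

namespace RunTumble

variable {d : ℕ} {V₀ : ℝ}

/-! ### Weighted `L¹` norms by duality with test functions -/

theorem isOpen_phaseSpace (V₀ : ℝ) :
    IsOpen ((univ : Set (Space d)) ×ˢ velocities d V₀) :=
  isOpen_univ.prod Metric.isOpen_ball

theorem exists_isTestFunction_eq_one {K O : Set (Space d × Space d)} (hK : IsCompact K)
    (hO : IsOpen O) (hKO : K ⊆ O) (hOV : O ⊆ univ ×ˢ velocities d V₀) :
    ∃ η, IsTestFunction V₀ η ∧ (∀ z, η z ∈ Icc (0 : ℝ) 1) ∧ (∀ z ∈ K, η z = 1) ∧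
      ∀ z, z ∉ O → η z = 0 := by
  obtain ⟨L, hL, hKL, hLO⟩ := exists_compact_between hK hO hKO
  obtain ⟨η, h1, h2, h3, h4⟩ := exists_contMDiff_support_eq_eq_one_iff
    (modelWithCornersSelf ℝ (Space d × Space d)) (n := ⊤) isOpen_interior hK.isClosed hKL
  have hsupp : tsupport η ⊆ L := by
    rw [tsupport, h3]
    exact closure_minimal interior_subset hL.isClosed
  refine ⟨η, ⟨h1.contDiff, hL.of_isClosed_subset (isClosed_tsupport _) hsupp,
    (hsupp.trans hLO).trans hOV⟩, fun z => h2 (mem_range_self z), fun z hz => (h4 z).1 hz,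
    fun z hz => ?_⟩
  by_contra h
  exact hz (hLO (hsupp (subset_tsupport _ h)))

theorem IsTestFunction.sub {φ ψ : Space d × Space d → ℝ} (hφ : IsTestFunction V₀ φ)
    (hψ : IsTestFunction V₀ ψ) : IsTestFunction V₀ (fun z => φ z - ψ z) := by
  have h : tsupport (fun z => φ z - ψ z) ⊆ tsupport φ ∪ tsupport ψ := by
    refine closure_minimal (fun z hz => ?_) ((isClosed_tsupport _).union (isClosed_tsupport _))
    by_contra h
    rw [mem_union, not_or] at h
    apply hz
    simp [image_eq_zero_of_notMem_tsupport h.1, image_eq_zero_of_notMem_tsupport h.2]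
  exact ⟨hφ.smooth.sub hψ.smooth, (hφ.compactSupport.isCompact.union
    hψ.compactSupport.isCompact).of_isClosed_subset (isClosed_tsupport _) h,
    h.trans (union_subset hφ.support_subset hψ.support_subset)⟩

theorem IsTestFunction.mul_smooth {w ψ : Space d × Space d → ℝ} (hψ : IsTestFunction V₀ ψ)
    (hw : ContDiff ℝ ∞ w) : IsTestFunction V₀ (fun z => w z * ψ z) :=
  hψ.of_tsupport_subset (hw.mul hψ.smooth) (tsupport_mul_subset_right (f := w) (g := ψ))

/-- The test function is a smooth substitute for sign G. Inner regularity of the finite measure |G|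
dx dv gives compact sets almost exhausting {G > 0} and {G < 0}; cutoffs equal to 1 on one and 0 on
the other are subtracted. Off a set S of small measure the product Gψ equals |G|, and on S at most
2|G| is lost. -/
theorem exists_isTestFunction_integral_abs_le {G : Space d × Space d → ℝ}
    (hG : Integrable G (phaseMeasure d V₀)) {ε : ℝ} (hε : 0 < ε) :
    ∃ ψ, IsTestFunction V₀ ψ ∧ (∀ z, |ψ z| ≤ 1) ∧
      ∫ z, |G z| ∂(phaseMeasure d V₀) ≤ ∫ z, G z * ψ z ∂(phaseMeasure d V₀) + ε := by
  set U : Set (Space d × Space d) := univ ×ˢ velocities d V₀ with hU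
  have hUo : IsOpen U := isOpen_phaseSpace V₀
  set G₀ := hG.1.mk G with hG₀
  have hGG : G =ᵐ[phaseMeasure d V₀] G₀ := hG.1.ae_eq_mk
  have hG₀m : Measurable G₀ := hG.1.stronglyMeasurable_mk.measurable
  have hG₀i : Integrable G₀ (phaseMeasure d V₀) := hG.congr hGG
  set ν := (phaseMeasure d V₀).withDensity (fun z => ‖G₀ z‖ₑ) with hν
  have hνfin : IsFiniteMeasure ν := isFiniteMeasure_withDensity hG₀i.2.ne
  have hνS : ∀ S, MeasurableSet S → ∫ z in S, |G₀ z| ∂(phaseMeasure d V₀) = (ν S).toReal := by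
    intro S hS
    rw [hν, withDensity_apply _ hS]
    exact integral_norm_eq_lintegral_enorm hG₀i.1.restrict
  -- Two exceptional sets, each counted with the factor 2, use up ε exactly.
  have hε' : ENNReal.ofReal (ε / 4) ≠ 0 := by
    rw [Ne, ENNReal.ofReal_eq_zero]
    linarith
  have hAm : MeasurableSet (U ∩ {z | 0 < G₀ z}) :=
    hUo.measurableSet.inter (measurableSet_lt measurable_const hG₀m)
  have hBm : MeasurableSet (U ∩ {z | G₀ z < 0}) :=
    hUo.measurableSet.inter (measurableSet_lt hG₀m measurable_const)
  obtain ⟨K₁, hK₁A, hK₁, hνK₁⟩ := hAm.exists_isCompact_sdiff_lt (measure_ne_top ν _) hε'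
  obtain ⟨K₂, hK₂B, hK₂, hνK₂⟩ := hBm.exists_isCompact_sdiff_lt (measure_ne_top ν _) hε'
  have hdisj : ∀ z, z ∈ K₁ → z ∉ K₂ := fun z h1 h2 => by
    have h3 : 0 < G₀ z := (hK₁A h1).2
    have h4 : G₀ z < 0 := (hK₂B h2).2
    linarith
  obtain ⟨η₁, ht₁, hr₁, ho₁, hz₁⟩ := exists_isTestFunction_eq_one (V₀ := V₀) hK₁
    (hUo.sdiff hK₂.isClosed) (fun z hz => ⟨(hK₁A hz).1, hdisj z hz⟩) sdiff_subset
  obtain ⟨η₂, ht₂, hr₂, ho₂, hz₂⟩ := exists_isTestFunction_eq_one (V₀ := V₀) hK₂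
    (hUo.sdiff hK₁.isClosed) (fun z hz => ⟨(hK₂B hz).1, fun h => hdisj z h hz⟩) sdiff_subset
  have hψ1 : ∀ z, |η₁ z - η₂ z| ≤ 1 := fun z =>
    abs_le.2 ⟨by linarith [(hr₁ z).1, (hr₂ z).2], by linarith [(hr₁ z).2, (hr₂ z).1]⟩
  refine ⟨fun z => η₁ z - η₂ z, ht₁.sub ht₂, hψ1, ?_⟩
  set S := ((U ∩ {z | 0 < G₀ z}) \ K₁) ∪ ((U ∩ {z | G₀ z < 0}) \ K₂) with hS
  have hSm : MeasurableSet S :=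
    (hAm.diff hK₁.measurableSet).union (hBm.diff hK₂.measurableSet)
  have hSν : (ν S).toReal ≤ ε / 2 := by
    apply ENNReal.toReal_le_of_le_ofReal (by linarith)
    calc ν S ≤ _ + _ := measure_union_le _ _
      _ ≤ ENNReal.ofReal (ε / 4) + ENNReal.ofReal (ε / 4) := add_le_add hνK₁.le hνK₂.le
      _ = ENNReal.ofReal (ε / 2) := by
        rw [← ENNReal.ofReal_add (by linarith) (by linarith)]
        congr 1
        ring
  have hi1 : Integrable (fun z => G₀ z * (η₁ z - η₂ z)) (phaseMeasure d V₀) :=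
    hG₀i.mul_bdd (c := 1) (ht₁.sub ht₂).smooth.continuous.aestronglyMeasurable (ae_of_all _ hψ1)
  have hi2 : Integrable (fun z => 2 * S.indicator (fun z => |G₀ z|) z) (phaseMeasure d V₀) :=
    (hG₀i.abs.indicator hSm).const_mul 2
  have hpt : ∀ z ∈ U, |G₀ z| ≤ G₀ z * (η₁ z - η₂ z) + 2 * S.indicator (fun z => |G₀ z|) z := by
    intro z hz
    have hbd : -|G₀ z| ≤ G₀ z * (η₁ z - η₂ z) := by
      have := abs_mul (G₀ z) (η₁ z - η₂ z)
      have h2 := mul_le_mul_of_nonneg_left (hψ1 z) (abs_nonneg (G₀ z))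
      linarith [neg_abs_le (G₀ z * (η₁ z - η₂ z))]
    by_cases hzS : z ∈ S
    · rw [indicator_of_mem hzS]
      linarith
    · rw [indicator_of_notMem hzS]
      rcases lt_trichotomy (G₀ z) 0 with h | h | h
      · have hK : z ∈ K₂ := by
          by_contra hK
          exact hzS (Or.inr ⟨⟨hz, h⟩, hK⟩)
        rw [ho₂ z hK, hz₁ z (fun h' => h'.2 hK), abs_of_neg h]
        linarith
      · simp [h]
      · have hK : z ∈ K₁ := by
          by_contra hK
          exact hzS (Or.inl ⟨⟨hz, h⟩, hK⟩)
        rw [ho₁ z hK, hz₂ z (fun h' => h'.2 hK), abs_of_pos h]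
        linarith
  have e1 : ∫ z, |G z| ∂(phaseMeasure d V₀) = ∫ z, |G₀ z| ∂(phaseMeasure d V₀) :=
    integral_congr_ae (hGG.fun_comp abs)
  have e2 : ∫ z, G z * (η₁ z - η₂ z) ∂(phaseMeasure d V₀) =
      ∫ z, G₀ z * (η₁ z - η₂ z) ∂(phaseMeasure d V₀) :=
    integral_congr_ae (hGG.mono fun z hz => by simp only [hz])
  have e3 := integral_mono_ae hG₀i.abs (hi1.add hi2)
    ((ae_mem_velocities V₀).mono fun z hz => hpt z ⟨mem_univ _, hz⟩)
  have e4 : ∫ z, 2 * S.indicator (fun z => |G₀ z|) z ∂(phaseMeasure d V₀) ≤ ε := by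
    rw [integral_const_mul, integral_indicator hSm, hνS S hSm]
    linarith
  have e5 : ∫ z, (G₀ z * (η₁ z - η₂ z) + 2 * S.indicator (fun z => |G₀ z|) z)
      ∂(phaseMeasure d V₀) = _ := integral_add hi1 hi2
  rw [e1, e2]
  calc _ ≤ _ := e3
    _ = _ := e5
    _ ≤ _ := by linarith

/-- Smoothness of w matters: if ψ approximates the sign of g w, then φ = wψ is itself a test
function dominated by w. -/
theorem integral_abs_mul_le_of_forall_isTestFunction {g w : Space d × Space d → ℝ} {B : ℝ}
    (hgw : Integrable (fun z => g z * w z) (phaseMeasure d V₀)) (hw : ContDiff ℝ ∞ w)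
    (hw0 : ∀ z, z.2 ∈ velocities d V₀ → 0 ≤ w z)
    (h : ∀ φ, IsTestFunction V₀ φ → (∀ z, z.2 ∈ velocities d V₀ → |φ z| ≤ w z) →
      ∫ z, g z * φ z ∂(phaseMeasure d V₀) ≤ B) :
    ∫ z, |g z| * w z ∂(phaseMeasure d V₀) ≤ B := by
  refine le_of_forall_pos_le_add fun ε hε => ?_
  obtain ⟨ψ, hψ, hψ1, hle⟩ := exists_isTestFunction_integral_abs_le hgw hε
  have h1 := h _ (hψ.mul_smooth hw) fun z hz => by
    rw [abs_mul, abs_of_nonneg (hw0 z hz)]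
    exact mul_le_of_le_one_right (hw0 z hz) (hψ1 z)
  have h2 : ∫ z, |g z| * w z ∂(phaseMeasure d V₀) = ∫ z, |g z * w z| ∂(phaseMeasure d V₀) :=
    integral_congr_ae ((ae_mem_velocities V₀).mono fun z hz => by
      simp only [abs_mul, abs_of_nonneg (hw0 z hz)])
  simp only [mul_assoc] at hle
  linarith

end RunTumble

namespace RunTumble

variable {d : ℕ} {χ V₀ γ : ℝ}

/-! ### Increments of a weak flow along the free transport -/

/-- Along r ↦ ∫ f(r) φ(x + (h − r)v, v) the transport terms cancel and only tumbling is left. The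
test function is frozen at time a: its Taylor expansion to time b gives −(b − a)v·∇ψ, the weak
equation gives the opposite term, and the two are evaluated at times differing by at most b − a.
That difference is controlled because v·∇ψ is again a test function. The image of ψ under `tumble`
is not one, K being discontinuous, so its pairing enters as a hypothesis. C depends on derivatives
of φ, which is harmless after subdivision. -/
theorem IsWeakFlow.integral_freeFlow_le {f : ℝ → Space d × Space d → ℝ}
    (hf : IsWeakFlow χ V₀ γ f) (hγ : 0 ≤ γ) (hV : volume (velocities d V₀) = 1)
    (hχ₀ : 0 < χ) (hχ₁ : χ < 1) {φ : Space d × Space d → ℝ} (hφ : IsTestFunction V₀ φ) {h M : ℝ}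
    (hM : ∀ r ∈ Icc 0 h, normL1Weight V₀ γ (f r) ≤ M) :
    ∃ C, ∀ a b c, 0 ≤ a → a ≤ b → b ≤ h →
      (∀ s ∈ Icc a b,
        ∫ z, f s z * tumble χ V₀ (freeFlow (h - a) φ) z ∂(phaseMeasure d V₀) ≤ c) →
      ∫ z, f b z * freeFlow (h - b) φ z ∂(phaseMeasure d V₀) ≤
        ∫ z, f a z * freeFlow (h - a) φ z ∂(phaseMeasure d V₀) + c * (b - a) + C * (b - a) ^ 2 := by
  obtain ⟨B₀, hB₀0, hB₀⟩ := hφ.exists_bound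
  obtain ⟨B₁, hB₁0, hB₁⟩ := hφ.streamDeriv.exists_bound
  obtain ⟨B₂, hB₂0, hB₂⟩ := hφ.streamDeriv.streamDeriv.exists_bound
  refine ⟨(B₂ + (B₂ + 4 * B₁)) * M, fun a b c ha hab hbh hc => ?_⟩
  have hb : 0 ≤ b := ha.trans hab
  set ψ := freeFlow (h - a) φ with hψdef
  have hψ : IsTestFunction V₀ ψ := hφ.freeFlow _
  have hDψ : IsTestFunction V₀ (streamDeriv ψ) := hψ.streamDeriv
  have hDψeq : streamDeriv ψ = freeFlow (h - a) (streamDeriv φ) :=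
    streamDeriv_freeFlow hφ.smooth _
  have hDψb : ∀ z, |streamDeriv ψ z| ≤ B₁ := fun z => by
    rw [hDψeq]
    exact hB₁ _
  have hLDψ : ∀ z, |dualOperator χ V₀ (streamDeriv ψ) z| ≤ B₂ + 4 * B₁ := fun z => by
    rw [dualOperator_eq]
    refine (abs_add_le _ _).trans (add_le_add ?_
      (abs_tumble_le hV hχ₀ hχ₁ (fun v _ => hDψb _) (hDψb z)))
    rw [hDψeq, streamDeriv_freeFlow hφ.streamDeriv.smooth]
    exact hB₂ _
  have hMnn : ∀ s ∈ Icc 0 h, ∀ k : ℝ, 0 ≤ k → k * normL1Weight V₀ γ (f s) ≤ k * M :=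
    fun s hs k hk => mul_le_mul_of_nonneg_left (hM s hs) hk
  have h1 : ∀ s ∈ Icc a b, ∫ z, f s z * streamDeriv ψ z ∂(phaseMeasure d V₀) ≤
      ∫ z, f b z * streamDeriv ψ z ∂(phaseMeasure d V₀) + (B₂ + 4 * B₁) * M * (b - a) := by
    intro s hs
    have e1 := hf.integral_sub _ hDψ s b (ha.trans hs.1) hs.2
    have e2 : ‖∫ r in s..b, ∫ z, f r z * dualOperator χ V₀ (streamDeriv ψ) z
        ∂(phaseMeasure d V₀)‖ ≤ (B₂ + 4 * B₁) * M * |b - s| := by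
      apply intervalIntegral.norm_integral_le_of_norm_le_const
      intro r hr
      rw [uIoc_of_le hs.2] at hr
      have hr0 : 0 ≤ r := (ha.trans hs.1).trans hr.1.le
      exact ((hf.mem r hr0).abs_integral_mul_le
        (fun z _ => le_mul_expWeight_of_abs_le hγ hLDψ z)).trans
        (hMnn r ⟨hr0, hr.2.trans hbh⟩ _ (by positivity))
    have hM0 : 0 ≤ M := (normL1Weight_nonneg _ _ _).trans (hM b ⟨hb, hbh⟩)
    rw [← e1, abs_of_nonneg (sub_nonneg.2 hs.2)] at e2
    have e3 := neg_le_of_abs_le e2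
    have e4 : (B₂ + 4 * B₁) * M * (b - s) ≤ (B₂ + 4 * B₁) * M * (b - a) := by
      have := hs.1
      gcongr
    linarith
  have hint : ∀ {s} {η : Space d × Space d → ℝ}, 0 ≤ s → IsTestFunction V₀ η →
      Integrable (fun z => f s z * η z) (phaseMeasure d V₀) := by
    intro s η hs hη
    obtain ⟨k, -, hk⟩ := hη.exists_bound
    exact (hf.mem s hs).integrable_mul_of_bounded hγ hη.smooth.continuous.aestronglyMeasurable hk
  have h2 : ∫ z, f b z * freeFlow (h - b) φ z ∂(phaseMeasure d V₀) -
      ∫ z, f b z * ψ z ∂(phaseMeasure d V₀) ≤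
      -((b - a) * ∫ z, f b z * streamDeriv ψ z ∂(phaseMeasure d V₀)) + B₂ * M * (b - a) ^ 2 := by
    have e1 : ∀ z, |freeFlow (h - b) φ z - ψ z + (b - a) * streamDeriv ψ z| ≤
        B₂ * (b - a) ^ 2 := by
      intro z
      have := abs_sub_sub_le_of_hasDerivAt (g := fun r => freeFlow (h - r) φ z)
        (g' := fun r => -freeFlow (h - r) (streamDeriv φ) z)
        (g'' := fun r => freeFlow (h - r) (streamDeriv (streamDeriv φ)) z) (C := B₂) hab
        (fun r => by
          simpa using (hasDerivAt_freeFlow hφ.differentiable z (h - r)).comp_const_sub h r)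
        (fun r => by
          simpa using ((hasDerivAt_freeFlow hφ.streamDeriv.differentiable z
            (h - r)).comp_const_sub h r).fun_neg)
        (fun r _ => hB₂ _)
      rw [hDψeq, hψdef]
      convert this using 2
      ring
    have e2 := (hf.mem b hb).abs_integral_mul_le (ψ := fun z =>
      freeFlow (h - b) φ z - ψ z + (b - a) * streamDeriv ψ z)
      (fun z _ => le_mul_expWeight_of_abs_le hγ e1 z)
    have e3 : ∫ z, f b z * (freeFlow (h - b) φ z - ψ z + (b - a) * streamDeriv ψ z)
        ∂(phaseMeasure d V₀) = ∫ z, f b z * freeFlow (h - b) φ z ∂(phaseMeasure d V₀) -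
        ∫ z, f b z * ψ z ∂(phaseMeasure d V₀) +
        (b - a) * ∫ z, f b z * streamDeriv ψ z ∂(phaseMeasure d V₀) := by
      rw [← integral_const_mul, ← MeasureTheory.integral_sub (hint hb (hφ.freeFlow _)) (hint hb hψ),
        ← integral_add (f := fun z => f b z * freeFlow (h - b) φ z - f b z * ψ z)
          ((hint hb (hφ.freeFlow _)).sub (hint hb hψ)) ((hint hb hDψ).const_mul _)]
      congr 1
      funext z
      ring
    rw [e3] at e2
    have e4 := hMnn b ⟨hb, hbh⟩ (B₂ * (b - a) ^ 2) (by positivity)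
    linarith [le_abs_self (∫ z, f b z * freeFlow (h - b) φ z ∂(phaseMeasure d V₀) -
        ∫ z, f b z * ψ z ∂(phaseMeasure d V₀) +
        (b - a) * ∫ z, f b z * streamDeriv ψ z ∂(phaseMeasure d V₀))]
  have h3 : ∫ z, f b z * ψ z ∂(phaseMeasure d V₀) - ∫ z, f a z * ψ z ∂(phaseMeasure d V₀) ≤
      (b - a) * (∫ z, f b z * streamDeriv ψ z ∂(phaseMeasure d V₀) +
        (B₂ + 4 * B₁) * M * (b - a) + c) := by
    rw [hf.integral_sub ψ hψ a b ha hab]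
    have e1 : ∀ s ∈ Icc a b, ∫ z, f s z * dualOperator χ V₀ ψ z ∂(phaseMeasure d V₀) ≤
        ∫ z, f b z * streamDeriv ψ z ∂(phaseMeasure d V₀) +
        (B₂ + 4 * B₁) * M * (b - a) + c := by
      intro s hs
      have hs0 := ha.trans hs.1
      have hψb : ∀ z, |ψ z| ≤ B₀ := fun z => hB₀ _
      have i2 : Integrable (fun z => f s z * tumble χ V₀ ψ z) (phaseMeasure d V₀) :=
        (hf.mem s hs0).integrable_mul_of_bounded hγ
          (measurable_tumble χ V₀ hψ.smooth.continuous).aestronglyMeasurable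
          (c := 4 * B₀) fun z => abs_tumble_le hV hχ₀ hχ₁ (fun v _ => hψb _) (hψb z)
      simp only [dualOperator_eq, mul_add]
      rw [integral_add (hint hs0 hDψ) i2]
      exact add_le_add (h1 s hs) (hc s hs)
    refine (intervalIntegral.integral_mono_on hab
      (hf.intervalIntegrable ψ hψ a b ha hb) intervalIntegrable_const e1).trans_eq ?_
    rw [intervalIntegral.integral_const, smul_eq_mul]
  nlinarith

theorem abs_freeFlow_le {φ : Space d × Space d → ℝ} {c τ : ℝ} (hγ : 0 ≤ γ) (hc0 : 0 ≤ c)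
    (hc : ∀ z, z.2 ∈ velocities d V₀ → |φ z| ≤ c * expWeight γ z.1) (hτ : 0 ≤ τ) (hτ1 : τ ≤ 1)
    {z : Space d × Space d} (hz : z.2 ∈ velocities d V₀) :
    |freeFlow τ φ z| ≤ c * Real.exp (γ * V₀) * expWeight γ z.1 := by
  have h1 : |freeFlow τ φ z| ≤ c * expWeight γ (z.1 + τ • z.2) := hc (z.1 + τ • z.2, z.2) hz
  refine h1.trans ?_
  rw [mul_assoc]
  exact mul_le_mul_of_nonneg_left (expWeight_add_smul_le hγ hτ hτ1 z.1 hz) hc0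

/-- The first-order error involves φ only through its size relative to e^{γ⟨x⟩}, not its
derivatives, so it is uniform over all test functions dominated by a given weight. -/
theorem IsWeakFlow.integral_mul_le_integral_freeFlow_add {f : ℝ → Space d × Space d → ℝ}
    (hf : IsWeakFlow χ V₀ γ f) (hγ : 0 ≤ γ) (hV : volume (velocities d V₀) = 1)
    (hχ₀ : 0 < χ) (hχ₁ : χ < 1) {φ : Space d × Space d → ℝ} (hφ : IsTestFunction V₀ φ)
    {r M c : ℝ} (hr0 : 0 ≤ r) (hr1 : r ≤ 1) (hc0 : 0 ≤ c)
    (hM : ∀ s ∈ Icc 0 r, normL1Weight V₀ γ (f s) ≤ M)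
    (hc : ∀ z, z.2 ∈ velocities d V₀ → |φ z| ≤ c * expWeight γ z.1) :
    ∫ z, f r z * φ z ∂(phaseMeasure d V₀) ≤
      ∫ z, f 0 z * freeFlow r φ z ∂(phaseMeasure d V₀) +
        4 * (c * Real.exp (γ * V₀)) * M * r := by
  obtain ⟨C, hC⟩ := hf.integral_freeFlow_le hγ hV hχ₀ hχ₁ hφ hM
  have htum : ∀ a, 0 ≤ a → a ≤ r → ∀ z : Space d × Space d, z.2 ∈ velocities d V₀ →
      |tumble χ V₀ (freeFlow (r - a) φ) z| ≤ 4 * (c * Real.exp (γ * V₀)) * expWeight γ z.1 := by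
    intro a ha har z hz
    have e : ∀ v ∈ velocities d V₀, |freeFlow (r - a) φ (z.1, v)| ≤
        c * Real.exp (γ * V₀) * expWeight γ z.1 := fun v hv =>
      abs_freeFlow_le hγ hc0 hc (by linarith) (by linarith) (z := (z.1, v)) hv
    rw [mul_assoc 4]
    exact abs_tumble_le hV hχ₀ hχ₁ e (e z.2 hz)
  have hinc : ∀ a b, 0 ≤ a → a ≤ b → b ≤ r → b - a ≤ 1 →
      ∫ z, f b z * freeFlow (r - b) φ z ∂(phaseMeasure d V₀) ≤
        ∫ z, f a z * freeFlow (r - a) φ z ∂(phaseMeasure d V₀) +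
          4 * (c * Real.exp (γ * V₀)) * M * (b - a) + C * (b - a) ^ 2 := by
    intro a b ha hab hbr _
    refine hC a b _ ha hab hbr fun s hs => ?_
    have hs0 := ha.trans hs.1
    have e1 := (hf.mem s hs0).abs_integral_mul_le (htum a ha (hab.trans hbr))
    have e2 : 4 * (c * Real.exp (γ * V₀)) * normL1Weight V₀ γ (f s) ≤
        4 * (c * Real.exp (γ * V₀)) * M :=
      mul_le_mul_of_nonneg_left (hM s ⟨hs0, hs.2.trans hbr⟩) (by positivity)
    exact (le_abs_self _).trans (e1.trans e2)
  have key := le_add_mul_of_increment_le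
    (G := fun s => ∫ z, f s z * freeFlow (r - s) φ z ∂(phaseMeasure d V₀)) hr0 one_pos hinc
  simp only [sub_self, freeFlow_zero, sub_zero] at key
  exact key

end RunTumble

namespace RunTumble

variable {d : ℕ} {χ V₀ γ : ℝ}

/-! ### Smooth weights comparable to `exp (γ ⟨x⟩)` -/

/-- A smooth weight `p` with `|p|` and `|v · ∇ₓ p|` bounded by `c exp (γ ⟨x⟩)` on phase space. -/
structure IsStreamBounded (V₀ γ c : ℝ) (p : Space d × Space d → ℝ) : Prop where
  smooth : ContDiff ℝ ∞ p
  nonneg : 0 ≤ c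
  bound : ∀ z, z.2 ∈ velocities d V₀ → |p z| ≤ c * expWeight γ z.1
  streamDeriv_bound : ∀ z, z.2 ∈ velocities d V₀ → |streamDeriv p z| ≤ c * expWeight γ z.1

namespace IsStreamBounded

variable {c : ℝ} {p : Space d × Space d → ℝ}

theorem aestronglyMeasurable (hp : IsStreamBounded V₀ γ c p) :
    AEStronglyMeasurable p (phaseMeasure d V₀) :=
  hp.smooth.continuous.aestronglyMeasurable

theorem abs_freeFlow_sub_le (hp : IsStreamBounded V₀ γ c p) (hγ : 0 ≤ γ) {τ : ℝ} (hτ : 0 ≤ τ)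
    (hτ1 : τ ≤ 1) {z : Space d × Space d} (hz : z.2 ∈ velocities d V₀) :
    |freeFlow τ p z - p z| ≤ c * Real.exp (γ * V₀) * τ * expWeight γ z.1 := by
  have h := abs_sub_le_of_hasDerivAt (C := c * Real.exp (γ * V₀) * expWeight γ z.1) hτ
    (fun r => hasDerivAt_freeFlow (differentiable_of_contDiff_infty hp.smooth) z r)
    (fun r hr => abs_freeFlow_le hγ hp.nonneg hp.streamDeriv_bound hr.1 (hr.2.trans hτ1) hz)
  rw [freeFlow_zero, sub_zero] at h
  linarith

theorem freeFlow_le (hp : IsStreamBounded V₀ γ c p) (hDp : IsStreamBounded V₀ γ c (streamDeriv p))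
    (hγ : 0 ≤ γ) {τ : ℝ} (hτ : 0 ≤ τ) (hτ1 : τ ≤ 1) {z : Space d × Space d}
    (hz : z.2 ∈ velocities d V₀) :
    freeFlow τ p z ≤ p z + τ * streamDeriv p z +
      c * Real.exp (γ * V₀) * τ ^ 2 * expWeight γ z.1 := by
  have h := abs_sub_sub_le_of_hasDerivAt (C := c * Real.exp (γ * V₀) * expWeight γ z.1) hτ
    (fun r => hasDerivAt_freeFlow (differentiable_of_contDiff_infty hp.smooth) z r)
    (fun r => hasDerivAt_freeFlow (differentiable_of_contDiff_infty hDp.smooth) z r)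
    (fun r hr => abs_freeFlow_le hγ hp.nonneg hDp.streamDeriv_bound hr.1 (hr.2.trans hτ1) hz)
  rw [freeFlow_zero, freeFlow_zero, sub_zero] at h
  linarith [le_of_abs_le h]

/-- Weighted integrals of `|f|` change at most linearly in time. -/
theorem integral_abs_mul_le (hp : IsStreamBounded V₀ γ c p)
    (hp0 : ∀ z, z.2 ∈ velocities d V₀ → 0 ≤ p z) {f : ℝ → Space d × Space d → ℝ}
    (hf : IsWeakFlow χ V₀ γ f) (hγ : 0 ≤ γ) (hV : volume (velocities d V₀) = 1)
    (hχ₀ : 0 < χ) (hχ₁ : χ < 1) {r M : ℝ} (hr0 : 0 ≤ r) (hr1 : r ≤ 1)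
    (hM : ∀ s ∈ Icc 0 r, normL1Weight V₀ γ (f s) ≤ M) :
    ∫ z, |f r z| * p z ∂(phaseMeasure d V₀) ≤
      ∫ z, |f 0 z| * p z ∂(phaseMeasure d V₀) + 5 * (c * Real.exp (γ * V₀)) * M * r := by
  have hf0 := hf.mem 0 le_rfl
  refine integral_abs_mul_le_of_forall_isTestFunction
    ((hf.mem r hr0).integrable_mul hp.aestronglyMeasurable hp.bound) hp.smooth hp0
    fun φ hφ hφp => ?_
  have hφc : ∀ z, z.2 ∈ velocities d V₀ → |φ z| ≤ c * expWeight γ z.1 := fun z hz =>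
    (hφp z hz).trans ((le_abs_self _).trans (hp.bound z hz))
  have h1 := hf.integral_mul_le_integral_freeFlow_add hγ hV hχ₀ hχ₁ hφ hr0 hr1 hp.nonneg hM hφc
  have hpr : ∀ z, z.2 ∈ velocities d V₀ →
      |freeFlow r p z| ≤ c * Real.exp (γ * V₀) * expWeight γ z.1 := fun z hz =>
    abs_freeFlow_le hγ hp.nonneg hp.bound hr0 hr1 hz
  have hprm : AEStronglyMeasurable (freeFlow r p) (phaseMeasure d V₀) :=
    (contDiff_freeFlow hp.smooth r).continuous.aestronglyMeasurable
  have h2 := hf0.integral_mul_le (ψ := freeFlow r φ) hprm hpr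
    (fun z hz => hφp (z.1 + r • z.2, z.2) hz)
  have h3 := hf0.integral_abs_mul_le_add hprm hpr hp.aestronglyMeasurable hp.bound
    (c'' := c * Real.exp (γ * V₀) * r)
    (fun z hz => by linarith [le_of_abs_le (hp.abs_freeFlow_sub_le hγ hr0 hr1 hz)])
  -- The constant 5 is 4 from tumbling plus 1 from replacing the transported weight by p.
  have hc0 := hp.nonneg
  have h4 : c * Real.exp (γ * V₀) * r * normL1Weight V₀ γ (f 0) ≤ c * Real.exp (γ * V₀) * r * M :=
    mul_le_mul_of_nonneg_left (hM 0 ⟨le_rfl, hr0⟩) (by positivity)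
  linarith

end IsStreamBounded

/-! ### The gain part of the tumbling operator -/

theorem integrableOn_velocities {φ : Space d × Space d → ℝ} (hφ : Continuous φ) (x : Space d) :
    IntegrableOn (fun v => φ (x, v)) (velocities d V₀) := by
  have h : Continuous (fun v => φ (x, v)) := by fun_prop
  exact (h.continuousOn.integrableOn_compact (isCompact_closedBall 0 V₀)).mono_set
    Metric.ball_subset_closedBall

theorem tumble_eq (hV : volume (velocities d V₀) = 1) {φ : Space d × Space d → ℝ}
    (hφ : Continuous φ) (z : Space d × Space d) :
    tumble χ V₀ φ z =
      turningKernel χ z.1 z.2 * ((∫ v in velocities d V₀, φ (z.1, v)) - φ z) := by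
  have h : Integrable (fun _ : Space d => φ z) (volume.restrict (velocities d V₀)) :=
    integrableOn_const (by simp [hV])
  rw [tumble, integral_sub (integrableOn_velocities hφ z.1) h, setIntegral_const]
  simp [Measure.real, hV]

/-- The gain operator `tumble + 2` is positive, with an error for transported functions. -/
theorem abs_tumble_freeFlow_add_le {c : ℝ} {φ p : Space d × Space d → ℝ}
    (hV : volume (velocities d V₀) = 1)
    (hχ₀ : 0 < χ) (hχ₁ : χ < 1) (hγ : 0 ≤ γ) (hφ : Continuous φ) (hp : IsStreamBounded V₀ γ c p)
    (hφp : ∀ z, z.2 ∈ velocities d V₀ → |φ z| ≤ p z) {τ : ℝ} (hτ : 0 ≤ τ) (hτ1 : τ ≤ 1)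
    {z : Space d × Space d} (hz : z.2 ∈ velocities d V₀) :
    |tumble χ V₀ (freeFlow τ φ) z + 2 * freeFlow τ φ z| ≤
      tumble χ V₀ p z + 2 * p z + 2 * (c * Real.exp (γ * V₀)) * τ * expWeight γ z.1 := by
  have hφτ : Continuous (freeFlow τ φ) := by
    unfold freeFlow
    fun_prop
  set E := c * Real.exp (γ * V₀) * τ * expWeight γ z.1 with hE
  have hb : ∀ v ∈ velocities d V₀, |freeFlow τ φ (z.1, v)| ≤ p (z.1, v) + E := by
    intro v hv
    have h1 : |freeFlow τ φ (z.1, v)| ≤ freeFlow τ p (z.1, v) := hφp (z.1 + τ • v, v) hv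
    have h2 := hp.abs_freeFlow_sub_le hγ hτ hτ1 (z := (z.1, v)) hv
    linarith [le_of_abs_le h2]
  obtain ⟨hK0, hK2⟩ := turningKernel_bounds hχ₀ hχ₁ z.1 z.2
  have hpi := integrableOn_velocities (V₀ := V₀) hp.smooth.continuous z.1
  have hEi : Integrable (fun _ : Space d => E) (volume.restrict (velocities d V₀)) :=
    integrableOn_const (by simp [hV])
  have h3 : |∫ v in velocities d V₀, freeFlow τ φ (z.1, v)| ≤
      (∫ v in velocities d V₀, p (z.1, v)) + E := by
    have h4 : ∫ v in velocities d V₀, (p (z.1, v) + E) =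
        (∫ v in velocities d V₀, p (z.1, v)) + E := by
      rw [integral_add hpi hEi, setIntegral_const]
      simp [Measure.real, hV]
    rw [← h4, ← Real.norm_eq_abs]
    exact norm_integral_le_of_norm_le (hpi.add hEi)
      ((ae_restrict_mem (measurableSet_velocities V₀)).mono hb)
  have h5 := hb z.2 hz
  rw [tumble_eq hV hφτ, tumble_eq hV hp.smooth.continuous]
  set K := turningKernel χ z.1 z.2
  set I := ∫ v in velocities d V₀, freeFlow τ φ (z.1, v)
  set J := ∫ v in velocities d V₀, p (z.1, v)
  -- Since 0 ≤ K ≤ 2 both coefficients are nonnegative, which is where the shift by 2 comes from.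
  have h6 : K * (I - freeFlow τ φ z) + 2 * freeFlow τ φ z =
      K * I + (2 - K) * freeFlow τ φ z := by ring
  have h7 : |K * I| ≤ K * (J + E) := by
    rw [abs_mul, abs_of_nonneg hK0]
    exact mul_le_mul_of_nonneg_left h3 hK0
  have h8 : |(2 - K) * freeFlow τ φ z| ≤ (2 - K) * (p z + E) := by
    rw [abs_mul, abs_of_nonneg (sub_nonneg.2 hK2)]
    exact mul_le_mul_of_nonneg_left h5 (sub_nonneg.2 hK2)
  rw [h6]
  refine (abs_add_le _ _).trans ((add_le_add h7 h8).trans_eq ?_)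
  rw [hE]
  ring

/-! ### One time step of the weighted estimate -/

/-- If `ℒ* p ≤ B - α p`, then over a short time `h` the weighted norm satisfies the corresponding
differential inequality up to an error of order `h²`. -/
theorem exists_integral_abs_mul_step {c α B : ℝ} {p : Space d × Space d → ℝ}
    (hV : volume (velocities d V₀) = 1) (hχ₀ : 0 < χ) (hχ₁ : χ < 1) (hγ : 0 ≤ γ)
    (hp : IsStreamBounded V₀ γ c p) (hDp : IsStreamBounded V₀ γ c (streamDeriv p))
    (hp0 : ∀ z, z.2 ∈ velocities d V₀ → 0 ≤ p z)
    (hL : ∀ z, z.2 ∈ velocities d V₀ → dualOperator χ V₀ p z ≤ B - α * p z) :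
    ∃ C, 0 ≤ C ∧ ∀ f : ℝ → Space d × Space d → ℝ, IsWeakFlow χ V₀ γ f →
      ∀ h M, 0 ≤ h → h ≤ 1 / 2 → (∀ r ∈ Icc 0 h, normL1Weight V₀ γ (f r) ≤ M) →
        ∫ z, |f h z| * p z ∂(phaseMeasure d V₀) ≤
          (1 - α * h) * (∫ z, |f 0 z| * p z ∂(phaseMeasure d V₀)) +
            B * h * (∫ z, |f 0 z| ∂(phaseMeasure d V₀)) + C * M * h ^ 2 := by
  set L := Real.exp (γ * V₀) with hLdef
  have hL0 : 0 < L := Real.exp_pos _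
  have hc0 := hp.nonneg
  -- The hypothesis ℒ*p ≤ B − αp is equivalent to tumble p + 2p ≤ q, so q dominates the gain
  -- operator applied to any |φ| ≤ p.
  set q : Space d × Space d → ℝ := fun z => (2 - α) * p z + B - streamDeriv p z with hq
  set cq := |2 - α| * c + |B| + c with hcq
  have hpd := differentiable_of_contDiff_infty hp.smooth
  have hDpd := differentiable_of_contDiff_infty hDp.smooth
  have hqs : ContDiff ℝ ∞ q := ((contDiff_const.mul hp.smooth).add contDiff_const).sub hDp.smooth
  have hDq : ∀ z, streamDeriv q z = (2 - α) * streamDeriv p z - streamDeriv (streamDeriv p) z := by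
    intro z
    apply streamDeriv_eq_of_hasDerivAt (differentiable_of_contDiff_infty hqs)
    have h1 := hasDerivAt_freeFlow hpd z 0
    have h2 := hasDerivAt_freeFlow hDpd z 0
    rw [freeFlow_zero] at h1 h2
    exact ((h1.const_mul (2 - α)).add_const B).sub h2
  have hqsb : IsStreamBounded V₀ γ cq q := by
    refine ⟨hqs, by positivity, fun z hz => ?_, fun z hz => ?_⟩
    · have h1 := hp.bound z hz
      have h2 := hp.streamDeriv_bound z hz
      have h3 := one_le_expWeight hγ z.1
      calc |q z| ≤ |(2 - α) * p z + B| + |streamDeriv p z| := abs_sub _ _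
        _ ≤ |(2 - α) * p z| + |B| + |streamDeriv p z| := by gcongr; exact abs_add_le _ _
        _ ≤ |2 - α| * (c * expWeight γ z.1) + |B| * expWeight γ z.1 + c * expWeight γ z.1 := by
          rw [abs_mul]
          gcongr
          exact le_mul_of_one_le_right (abs_nonneg _) h3
        _ = cq * expWeight γ z.1 := by rw [hcq]; ring
    · have h1 := hDp.bound z hz
      have h2 := hDp.streamDeriv_bound z hz
      have h3 := expWeight_pos γ z.1
      rw [hDq]
      calc |(2 - α) * streamDeriv p z - streamDeriv (streamDeriv p) z|
          ≤ |(2 - α) * streamDeriv p z| + |streamDeriv (streamDeriv p) z| := abs_sub _ _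
        _ ≤ |2 - α| * (c * expWeight γ z.1) + c * expWeight γ z.1 := by
          rw [abs_mul]
          gcongr
        _ ≤ cq * expWeight γ z.1 := by
          rw [hcq]
          nlinarith [mul_nonneg (abs_nonneg B) h3.le]
  have hgain : ∀ z, z.2 ∈ velocities d V₀ → tumble χ V₀ p z + 2 * p z ≤ q z := by
    intro z hz
    have := hL z hz
    rw [dualOperator_eq] at this
    simp only [hq]
    linarith
  have hq0 : ∀ z, z.2 ∈ velocities d V₀ → 0 ≤ q z := by
    intro z hz
    have h1 := abs_tumble_freeFlow_add_le hV hχ₀ hχ₁ hγ (φ := p) hp.smooth.continuous hp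
      (fun z hz => (abs_of_nonneg (hp0 z hz)).le) le_rfl zero_le_one hz
    rw [freeFlow_zero, mul_zero, zero_mul, add_zero] at h1
    exact (abs_nonneg _).trans (h1.trans (hgain z hz))
  -- The three terms come from the drift of ∫|f|q in time, the transport error in the gain bound,
  -- and twice the error 4 of the loss term. None depends on φ.
  set C₂ := 5 * (cq * L) + 2 * (c * L) + 8 * (c * L * L) with hC₂
  have hcq0 : 0 ≤ cq := hqsb.nonneg
  refine ⟨C₂ + c * L + 2 * c, by positivity, fun f hf h M hh0 hh2 hM => ?_⟩
  have hf0 := hf.mem 0 le_rfl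
  have hM0 : 0 ≤ M := (normL1Weight_nonneg _ _ _).trans (hM 0 ⟨le_rfl, hh0⟩)
  have hMf0 : normL1Weight V₀ γ (f 0) ≤ M := hM 0 ⟨le_rfl, hh0⟩
  refine integral_abs_mul_le_of_forall_isTestFunction
    ((hf.mem h hh0).integrable_mul hp.aestronglyMeasurable hp.bound) hp.smooth hp0
    fun φ hφ hφp => ?_
  have hφc : ∀ z, z.2 ∈ velocities d V₀ → |φ z| ≤ c * expWeight γ z.1 := fun z hz =>
    (hφp z hz).trans ((le_abs_self _).trans (hp.bound z hz))
  obtain ⟨B₁, hB₁0, hB₁⟩ := hφ.streamDeriv.exists_bound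
  obtain ⟨C, hC⟩ := hf.integral_freeFlow_le hγ hV hχ₀ hχ₁ hφ hM
  set G : ℝ → ℝ := fun r => ∫ z, f r z * freeFlow (h - r) φ z ∂(phaseMeasure d V₀) with hG
  set Q := ∫ z, |f 0 z| * q z ∂(phaseMeasure d V₀) with hQ
  have hint : ∀ {s} {η : Space d × Space d → ℝ}, 0 ≤ s → IsTestFunction V₀ η →
      Integrable (fun z => f s z * η z) (phaseMeasure d V₀) := by
    intro s η hs hη
    obtain ⟨k, -, hk⟩ := hη.exists_bound
    exact (hf.mem s hs).integrable_mul_of_bounded hγ hη.smooth.continuous.aestronglyMeasurable hk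
  have htum : ∀ a b s, 0 ≤ a → a ≤ s → s ≤ b → b ≤ h →
      ∫ z, f s z * tumble χ V₀ (freeFlow (h - a) φ) z ∂(phaseMeasure d V₀) ≤
        Q - 2 * G 0 + C₂ * M * h + 2 * (B₁ * M) * (b - a) := by
    intro a b s ha has hsb hbh
    have hs0 : 0 ≤ s := ha.trans has
    have hfs := hf.mem s hs0
    have hMs : ∀ r ∈ Icc 0 s, normL1Weight V₀ γ (f r) ≤ M := fun r hr =>
      hM r ⟨hr.1, hr.2.trans (hsb.trans hbh)⟩
    set τ := h - a with hτ
    have hτ0 : 0 ≤ τ := by linarith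
    have hτ1 : τ ≤ 1 := by linarith
    have hφτ := hφ.freeFlow τ
    -- the gain term
    have e1 : ∫ z, f s z * (tumble χ V₀ (freeFlow τ φ) z + 2 * freeFlow τ φ z)
        ∂(phaseMeasure d V₀) ≤ Q + (5 * (cq * L) * M * s + 2 * (c * L) * τ * M) := by
      have k2 := hfs.integral_mul_le
        (ψ := fun z => tumble χ V₀ (freeFlow τ φ) z + 2 * freeFlow τ φ z)
        (w := fun z => q z + 2 * (c * L) * τ * expWeight γ z.1)
        (c := cq + 2 * (c * L) * τ)
        (hqsb.aestronglyMeasurable.add (((contDiff_expWeight γ).continuous.comp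
          continuous_fst).const_mul _).aestronglyMeasurable)
        (fun z hz => by
          have h1 := hqsb.bound z hz
          have h3 := expWeight_pos γ z.1
          rw [add_mul]
          refine (abs_add_le _ _).trans (add_le_add h1 ?_)
          rw [abs_of_nonneg (by positivity)])
        (fun z hz => (abs_tumble_freeFlow_add_le hV hχ₀ hχ₁ hγ hφ.smooth.continuous hp hφp
          hτ0 hτ1 hz).trans (by linarith [hgain z hz]))
      have k3 : ∫ z, |f s z| * (q z + 2 * (c * L) * τ * expWeight γ z.1) ∂(phaseMeasure d V₀) =
          ∫ z, |f s z| * q z ∂(phaseMeasure d V₀) + 2 * (c * L) * τ * normL1Weight V₀ γ (f s) := by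
        rw [normL1Weight, ← integral_const_mul, ← integral_add
          (hfs.abs.integrable_mul hqsb.aestronglyMeasurable hqsb.bound)
          (hfs.integrable_abs_mul.const_mul _)]
        congr 1
        funext z
        ring
      have k4 := hqsb.integral_abs_mul_le hq0 hf hγ hV hχ₀ hχ₁ hs0 (by linarith) hMs
      have k5 : 2 * (c * L) * τ * normL1Weight V₀ γ (f s) ≤ 2 * (c * L) * τ * M :=
        mul_le_mul_of_nonneg_left (hMs s ⟨hs0, le_rfl⟩) (by positivity)
      linarith
    -- the loss term
    have e2 : -∫ z, f s z * freeFlow τ φ z ∂(phaseMeasure d V₀) ≤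
        -G 0 + B₁ * (s - a) * M + 4 * (c * L * L) * M * s := by
      -- A lower bound for the loss pairing is needed, so the upper bound is applied to −φ. The
      -- transported time s + τ equals h + (s − a), close to the time h defining G 0.
      have k1 := hf.integral_mul_le_integral_freeFlow_add hγ hV hχ₀ hχ₁ hφτ.neg hs0 (by linarith)
        (c := c * L) (by positivity) hMs (fun z hz => by
          rw [abs_neg]
          exact abs_freeFlow_le hγ hc0 hφc hτ0 hτ1 hz)
      have k2 : ∫ z, f 0 z * freeFlow s (fun z => -freeFlow τ φ z) z ∂(phaseMeasure d V₀) =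
          -∫ z, f 0 z * freeFlow (s + τ) φ z ∂(phaseMeasure d V₀) := by
        rw [← integral_neg, ← freeFlow_freeFlow]
        congr 1
        funext z
        simp only [freeFlow]
        ring
      have k3 : G 0 - ∫ z, f 0 z * freeFlow (s + τ) φ z ∂(phaseMeasure d V₀) ≤
          B₁ * (s - a) * M := by
        simp only [hG, sub_zero]
        rw [← integral_sub (hint le_rfl (hφ.freeFlow _)) (hint le_rfl (hφ.freeFlow _))]
        have k4 : ∀ z, |freeFlow h φ z - freeFlow (s + τ) φ z| ≤ B₁ * (s - a) := by
          intro z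
          have := abs_sub_le_of_hasDerivAt (a := h) (b := s + τ) (C := B₁) (by linarith)
            (fun r => hasDerivAt_freeFlow hφ.differentiable z r) (fun r _ => hB₁ _)
          rw [abs_sub_comm]
          refine this.trans_eq ?_
          rw [hτ]
          ring
        have k5 := hf0.abs_integral_mul_le fun z (_ : z.2 ∈ velocities d V₀) =>
          le_mul_expWeight_of_abs_le hγ k4 z
        simp only [mul_sub] at k5
        refine (le_abs_self _).trans (k5.trans ?_)
        have : 0 ≤ s - a := sub_nonneg.2 has
        rw [← mul_sub]
        exact mul_le_mul_of_nonneg_left hMf0 (by positivity)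
      simp only [mul_neg, integral_neg] at k1 k2
      linarith
    have e3 : ∫ z, f s z * (tumble χ V₀ (freeFlow τ φ) z + 2 * freeFlow τ φ z)
        ∂(phaseMeasure d V₀) =
        ∫ z, f s z * tumble χ V₀ (freeFlow τ φ) z ∂(phaseMeasure d V₀) +
        2 * ∫ z, f s z * freeFlow τ φ z ∂(phaseMeasure d V₀) := by
      obtain ⟨k, -, hk⟩ := hφτ.exists_bound
      rw [← integral_const_mul, ← integral_add
        (hfs.integrable_mul_of_bounded hγ
          (measurable_tumble χ V₀ hφτ.smooth.continuous).aestronglyMeasurable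
          (c := 4 * k) fun z => abs_tumble_le hV hχ₀ hχ₁ (fun v _ => hk _) (hk z))
        ((hint hs0 hφτ).const_mul 2)]
      congr 1
      funext z
      ring
    have hsh : s ≤ h := hsb.trans hbh
    have hτh : τ ≤ h := by linarith
    have e4 : 5 * (cq * L) * M * s ≤ 5 * (cq * L) * M * h := by gcongr
    have e5 : 2 * (c * L) * τ * M ≤ 2 * (c * L) * h * M := by gcongr
    have e6 : 4 * (c * L * L) * M * s ≤ 4 * (c * L * L) * M * h := by gcongr
    have e7 : B₁ * (s - a) * M ≤ B₁ * (b - a) * M := by gcongr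
    rw [hC₂]
    linarith
  -- The φ-dependent part of the tumbling bound carries a factor b − a, so it joins the quadratic
  -- error and vanishes; the φ-independent C₂Mh survives and yields C₂Mh².
  have hGh : G h ≤ G 0 + (Q - 2 * G 0 + C₂ * M * h) * h := by
    refine le_add_mul_of_increment_le (C := C + 2 * (B₁ * M)) hh0 one_pos
      fun a b ha hab hbh _ => ?_
    have := hC a b _ ha hab hbh fun s hs => htum a b s ha hs.1 hs.2 hbh
    linarith
  have hG0 : G 0 ≤ ∫ z, |f 0 z| * (p z + h * streamDeriv p z) ∂(phaseMeasure d V₀) +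
      c * L * h ^ 2 * normL1Weight V₀ γ (f 0) := by
    have hph : ∀ z, z.2 ∈ velocities d V₀ → |freeFlow h p z| ≤ c * L * expWeight γ z.1 :=
      fun z hz => abs_freeFlow_le hγ hc0 hp.bound hh0 (by linarith) hz
    have hphm : AEStronglyMeasurable (freeFlow h p) (phaseMeasure d V₀) :=
      (contDiff_freeFlow hp.smooth h).continuous.aestronglyMeasurable
    have k1 := hf0.integral_mul_le (ψ := freeFlow h φ) hphm hph
      (fun z hz => hφp (z.1 + h • z.2, z.2) hz)
    have k2 := hf0.integral_abs_mul_le_add (w' := fun z => p z + h * streamDeriv p z)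
      (c' := c + h * c) hphm hph
      (hp.aestronglyMeasurable.add (hDp.aestronglyMeasurable.const_mul h))
      (fun z hz => by
        refine (abs_add_le _ _).trans ?_
        rw [abs_mul, abs_of_nonneg hh0]
        have := mul_le_mul_of_nonneg_left (hp.streamDeriv_bound z hz) hh0
        linarith [hp.bound z hz])
      (fun z hz => hp.freeFlow_le hDp hγ hh0 (by linarith) hz)
    simp only [hG, sub_zero]
    exact k1.trans k2
  have ip := hf0.abs.integrable_mul hp.aestronglyMeasurable hp.bound
  have iDp := hf0.abs.integrable_mul hDp.aestronglyMeasurable hDp.bound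
  have i1 : Integrable (fun z => |f 0 z|) (phaseMeasure d V₀) := by
    simpa using hf0.abs.integrable_mul_of_bounded hγ (ψ := fun _ => 1) (c := 1)
      aestronglyMeasurable_const (by simp)
  set P₀ := ∫ z, |f 0 z| * p z ∂(phaseMeasure d V₀) with hP₀
  set D₀ := ∫ z, |f 0 z| * streamDeriv p z ∂(phaseMeasure d V₀) with hD₀
  set N₀ := ∫ z, |f 0 z| ∂(phaseMeasure d V₀) with hN₀
  have hQeq : Q = (2 - α) * P₀ + B * N₀ - D₀ := by
    rw [hQ, hP₀, hD₀, hN₀, ← integral_const_mul, ← integral_const_mul, ← integral_add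
      (ip.const_mul _) (i1.const_mul _), ← integral_sub
      (f := fun z => (2 - α) * (|f 0 z| * p z) + B * |f 0 z|)
      ((ip.const_mul _).add (i1.const_mul _)) iDp]
    congr 1
    funext z
    simp only [hq]
    ring
  have hPD : ∫ z, |f 0 z| * (p z + h * streamDeriv p z) ∂(phaseMeasure d V₀) = P₀ + h * D₀ := by
    rw [hP₀, hD₀, ← integral_const_mul, ← integral_add ip (iDp.const_mul _)]
    congr 1
    funext z
    ring
  have hD₀b : -(c * M) ≤ D₀ := by
    have k1 := hf0.abs.abs_integral_mul_le hDp.bound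
    rw [normL1Weight_abs] at k1
    linarith [neg_le_of_abs_le k1, mul_le_mul_of_nonneg_left hMf0 hc0]
  have hGhe : ∫ z, f h z * φ z ∂(phaseMeasure d V₀) = G h := by
    simp only [hG, sub_self, freeFlow_zero]
  rw [hGhe]
  rw [hPD] at hG0
  have hG0' : G 0 ≤ P₀ + h * D₀ + c * L * h ^ 2 * M :=
    hG0.trans (by gcongr)
  -- Only an upper bound on G 0 is available, so its coefficient 1 − 2h must be nonnegative. On
  -- expanding, hD₀ cancels the −hD₀ contained in hQ, and the leftover −2h²D₀ costs 2cMh².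
  have h12 : 0 ≤ 1 - 2 * h := by linarith
  have step := mul_le_mul_of_nonneg_left hG0' h12
  have hD₂ := mul_le_mul_of_nonneg_left hD₀b (show 0 ≤ 2 * h ^ 2 by positivity)
  have hLh : 0 ≤ c * L * h ^ 3 * M := by positivity
  rw [hQeq] at hGh
  nlinarith

end RunTumble

namespace RunTumble

variable {d : ℕ} {χ V₀ γ : ℝ}

/-! ### Global-in-time bounds for weak flows -/

theorem streamDeriv_const (k : ℝ) : streamDeriv (fun _ : Space d × Space d => k) = fun _ => 0 := by
  funext z
  simp [streamDeriv]

theorem isStreamBounded_const (hγ : 0 ≤ γ) {k : ℝ} (hk : |k| ≤ 1) :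
    IsStreamBounded V₀ γ 1 (fun _ : Space d × Space d => k) where
  smooth := contDiff_const
  nonneg := zero_le_one
  bound z _ := by
    rw [one_mul]
    exact hk.trans (one_le_expWeight hγ z.1)
  streamDeriv_bound z _ := by
    rw [streamDeriv_const, abs_zero, one_mul]
    exact (expWeight_pos γ z.1).le

/-- Constants are annihilated by ℒ*, so the one-step estimate applies with p = 1 and α = B = 0. -/
theorem IsWeakFlow.integral_abs_le {f : ℝ → Space d × Space d → ℝ} (hf : IsWeakFlow χ V₀ γ f)
    (hV : volume (velocities d V₀) = 1) (hχ₀ : 0 < χ) (hχ₁ : χ < 1) (hγ : 0 ≤ γ) {t M : ℝ}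
    (ht : 0 ≤ t) (hM : ∀ r ∈ Icc 0 t, normL1Weight V₀ γ (f r) ≤ M) :
    ∫ z, |f t z| ∂(phaseMeasure d V₀) ≤ ∫ z, |f 0 z| ∂(phaseMeasure d V₀) := by
  obtain ⟨C, -, hC⟩ := exists_integral_abs_mul_step (d := d) (α := 0) (B := 0) hV hχ₀ hχ₁ hγ
    (isStreamBounded_const hγ (k := 1) (by simp))
    (by rw [streamDeriv_const]; exact isStreamBounded_const hγ (by simp))
    (fun z _ => zero_le_one) (fun z _ => by
      rw [dualOperator_eq, streamDeriv_const]
      simp [tumble])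
  have key := le_add_mul_of_increment_le (G := fun s => ∫ z, |f s z| ∂(phaseMeasure d V₀))
    (A := 0) (C := C * M) ht (show (0 : ℝ) < 1 / 2 by norm_num) (fun a b ha hab hbt hab2 => by
      have := hC _ (hf.shift ha) (b - a) M (by linarith) hab2
        (fun r hr => hM _ ⟨by linarith [hr.1], by linarith [hr.2]⟩)
      simpa using this)
  simpa using key

/-- A weight with `ℒ* p ≤ B - α p` yields a bound uniform in time. -/
theorem IsWeakFlow.integral_abs_mul_le_max {f : ℝ → Space d × Space d → ℝ}
    (hf : IsWeakFlow χ V₀ γ f) {c α B : ℝ} {p : Space d × Space d → ℝ}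
    (hV : volume (velocities d V₀) = 1) (hχ₀ : 0 < χ) (hχ₁ : χ < 1) (hγ : 0 ≤ γ)
    (hp : IsStreamBounded V₀ γ c p) (hDp : IsStreamBounded V₀ γ c (streamDeriv p))
    (hp0 : ∀ z, z.2 ∈ velocities d V₀ → 0 ≤ p z) (hα : 0 < α) (hB : 0 ≤ B)
    (hL : ∀ z, z.2 ∈ velocities d V₀ → dualOperator χ V₀ p z ≤ B - α * p z) {t M : ℝ}
    (ht : 0 ≤ t) (hM : ∀ r ∈ Icc 0 t, normL1Weight V₀ γ (f r) ≤ M) :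
    ∫ z, |f t z| * p z ∂(phaseMeasure d V₀) ≤
      max (B / α * ∫ z, |f 0 z| ∂(phaseMeasure d V₀)) (∫ z, |f 0 z| * p z ∂(phaseMeasure d V₀)) := by
  obtain ⟨C, hC0, hC⟩ := exists_integral_abs_mul_step hV hχ₀ hχ₁ hγ hp hDp hp0 hL
  have hM0 : 0 ≤ M := (normL1Weight_nonneg _ _ _).trans (hM 0 ⟨le_rfl, ht⟩)
  set A := B / α * ∫ z, |f 0 z| ∂(phaseMeasure d V₀) with hA
  have hαA : α * A = B * ∫ z, |f 0 z| ∂(phaseMeasure d V₀) := by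
    rw [hA]
    field_simp
  -- For steps of length at most 1/α the one-step bound is a convex combination of A and the
  -- previous value, up to a quadratic error, so the maximum with A grows by at most that error.
  have key := le_add_mul_of_increment_le
    (G := fun s => max A (∫ z, |f s z| * p z ∂(phaseMeasure d V₀)))
    (A := 0) (C := C * M) ht (show (0 : ℝ) < min (1 / 2) (1 / α) by positivity)
    (fun a b ha hab hbt hab2 => by
      have h1 := hC _ (hf.shift ha) (b - a) M (by linarith) (hab2.trans (min_le_left _ _))
        (fun r hr => hM _ ⟨by linarith [hr.1], by linarith [hr.2]⟩)
      simp only [add_sub_cancel, add_zero] at h1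
      have h2 := hf.integral_abs_le hV hχ₀ hχ₁ hγ ha
        (fun r hr => hM r ⟨hr.1, hr.2.trans (hab.trans hbt)⟩)
      have h3 : α * (b - a) ≤ 1 := by
        have := mul_le_mul_of_nonneg_left (hab2.trans (min_le_right _ _)) hα.le
        rwa [mul_one_div_cancel hα.ne'] at this
      have h4 : 0 ≤ b - a := sub_nonneg.2 hab
      have h5 : 0 ≤ C * M * (b - a) ^ 2 := by positivity
      have h6 := le_max_left A (∫ z, |f a z| * p z ∂(phaseMeasure d V₀))
      have h7 := le_max_right A (∫ z, |f a z| * p z ∂(phaseMeasure d V₀))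
      rw [zero_mul, add_zero]
      refine max_le (by linarith) (h1.trans ?_)
      have h8 : B * (b - a) * ∫ z, |f a z| ∂(phaseMeasure d V₀) ≤ α * (b - a) * A := by
        have := mul_le_mul_of_nonneg_left h2 (mul_nonneg hB h4)
        linear_combination this - (b - a) * hαA
      have h9 := mul_le_mul_of_nonneg_left h7 (sub_nonneg.2 h3)
      have h10 := mul_le_mul_of_nonneg_left h6 (mul_nonneg hα.le h4)
      linarith)
  rw [zero_mul, add_zero] at key
  exact (le_max_right _ _).trans key

end RunTumble

namespace RunTumble

variable {d : ℕ} {χ V₀ γ : ℝ}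

/-! ### Moments of the velocity set -/

theorem pos_of_volume_velocities (hV : volume (velocities d V₀) = 1) : 0 < V₀ := by
  by_contra h
  rw [velocities, Metric.ball_eq_empty.2 (not_lt.1 h)] at hV
  simp at hV

theorem setIntegral_velocities_comp (T : Space d ≃ₗᵢ[ℝ] Space d) (g : Space d → ℝ) :
    ∫ v in velocities d V₀, g (T v) = ∫ v in velocities d V₀, g v := by
  have h := T.measurePreserving.setIntegral_preimage_emb
    T.toHomeomorph.measurableEmbedding g (velocities d V₀)
  have h2 : T ⁻¹' velocities d V₀ = velocities d V₀ := by
    ext v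
    simp [velocities]
  rwa [h2] at h

theorem setIntegral_inner_velocities (x : Space d) :
    ∫ v in velocities d V₀, inner ℝ x v = 0 := by
  have h := setIntegral_velocities_comp (V₀ := V₀) (LinearIsometryEquiv.neg ℝ) (fun v => inner ℝ x v)
  simp only [LinearIsometryEquiv.coe_neg, inner_neg_right, integral_neg] at h
  linarith

/-- Rotational invariance of the ball: a reflection carries x to ‖x‖e for a fixed unit vector e, so
κ is the second moment in the direction e. -/
theorem exists_setIntegral_inner_sq (hd : 1 ≤ d) (hV₀ : 0 < V₀) :
    ∃ κ : ℝ, 0 < κ ∧ ∀ x : Space d, ∫ v in velocities d V₀, inner ℝ x v ^ 2 = κ * ‖x‖ ^ 2 := by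
  obtain ⟨e, he⟩ : ∃ e : Space d, ‖e‖ = 1 :=
    ⟨EuclideanSpace.single ⟨0, hd⟩ 1, by simp⟩
  have hcont : Continuous (fun v : Space d => inner ℝ e v ^ 2) := by fun_prop
  refine ⟨∫ v in velocities d V₀, inner ℝ e v ^ 2, ?_, fun x => ?_⟩
  · have hint : IntegrableOn (fun v : Space d => inner ℝ e v ^ 2) (velocities d V₀) :=
      (hcont.continuousOn.integrableOn_compact (isCompact_closedBall 0 V₀)).mono_set
        Metric.ball_subset_closedBall
    rw [setIntegral_pos_iff_support_of_nonneg_ae (ae_of_all _ fun v => sq_nonneg _) hint]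
    have hopen : IsOpen (Function.support (fun v : Space d => inner ℝ e v ^ 2) ∩ velocities d V₀) :=
      hcont.isOpen_support.inter Metric.isOpen_ball
    refine hopen.measure_pos _ ⟨(V₀ / 2) • e, ?_, ?_⟩
    · simp only [Function.mem_support, inner_smul_right, real_inner_self_eq_norm_sq, he]
      positivity
    · rw [velocities, mem_ball_zero_iff, norm_smul, he, Real.norm_of_nonneg (by positivity)]
      linarith
  · have hn : ‖x‖ = ‖‖x‖ • e‖ := by
      rw [norm_smul, he, norm_norm, mul_one]
    have hT := Submodule.reflection_sub hn
    set T := (Submodule.span ℝ {x - ‖x‖ • e})ᗮ.reflection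
    have h := setIntegral_velocities_comp (V₀ := V₀) T (fun v => inner ℝ (T x) v ^ 2)
    simp only [LinearIsometryEquiv.inner_map_map] at h
    rw [h, hT, mul_comm, ← integral_const_mul]
    congr 1
    funext v
    rw [real_inner_smul_left]
    ring

/-! ### The modified weight -/

/-- The normalized radial velocity `x · v / ⟨x⟩`. -/
noncomputable def radialVelocity (z : Space d × Space d) : ℝ := inner ℝ z.1 z.2 / bracket z.1

theorem bracket_pos (x : Space d) : 0 < bracket x := zero_lt_one.trans_le (one_le_bracket x)

theorem abs_radialVelocity_le (z : Space d × Space d) : |radialVelocity z| ≤ ‖z.2‖ := by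
  rw [radialVelocity, abs_div, abs_of_pos (bracket_pos z.1), div_le_iff₀ (bracket_pos z.1)]
  refine (abs_real_inner_le_norm _ _).trans ?_
  rw [mul_comm]
  exact mul_le_mul_of_nonneg_left (norm_le_bracket z.1) (norm_nonneg _)

theorem contDiff_radialVelocity : ContDiff ℝ ∞ (radialVelocity : Space d × Space d → ℝ) := by
  have h : ContDiff ℝ ∞ (fun z : Space d × Space d => bracket z.1) :=
    contDiff_bracket.comp contDiff_fst
  exact (contDiff_fst.inner ℝ contDiff_snd).div h fun z => (bracket_pos z.1).ne'

theorem hasDerivAt_bracket (z : Space d × Space d) :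
    HasDerivAt (fun r : ℝ => bracket (z.1 + r • z.2)) (radialVelocity z) 0 := by
  have h1 : HasDerivAt (fun r : ℝ => z.1 + r • z.2) z.2 0 := by
    simpa using ((hasDerivAt_id (0 : ℝ)).smul_const z.2).const_add z.1
  have h2 := (h1.norm_sq.const_add 1).sqrt (by positivity)
  refine h2.congr_deriv ?_
  simp only [zero_smul, add_zero, radialVelocity, bracket]
  rw [mul_div_mul_left _ _ two_ne_zero]

theorem hasDerivAt_radialVelocity (z : Space d × Space d) :
    HasDerivAt (fun r : ℝ => radialVelocity (z.1 + r • z.2, z.2))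
      ((‖z.2‖ ^ 2 - radialVelocity z ^ 2) * (bracket z.1)⁻¹) 0 := by
  have h1 : HasDerivAt (fun r : ℝ => z.1 + r • z.2) z.2 0 := by
    simpa using ((hasDerivAt_id (0 : ℝ)).smul_const z.2).const_add z.1
  have h2 := (h1.inner ℝ (hasDerivAt_const 0 z.2)).div (hasDerivAt_bracket z)
    (bracket_pos _).ne'
  refine h2.congr_deriv ?_
  have h3 := (bracket_pos z.1).ne'
  simp only [zero_smul, add_zero, inner_zero_right, zero_add, real_inner_self_eq_norm_sq]
  have h4 : inner ℝ z.1 z.2 = radialVelocity z * bracket z.1 := by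
    rw [radialVelocity]
    field_simp
  rw [h4]
  field_simp

/-- The weight `exp (γ ⟨x⟩) (1 + γ a - γ β a²)` with `a = x · v / ⟨x⟩`. -/
noncomputable def modifiedWeight (γ β : ℝ) (z : Space d × Space d) : ℝ :=
  expWeight γ z.1 * (1 + γ * radialVelocity z - γ * β * radialVelocity z ^ 2)

theorem contDiff_modifiedWeight (γ β : ℝ) :
    ContDiff ℝ ∞ (modifiedWeight γ β : Space d × Space d → ℝ) :=
  ((contDiff_expWeight γ).comp contDiff_fst).mul
    ((contDiff_const.add (contDiff_const.mul contDiff_radialVelocity)).sub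
      (contDiff_const.mul (contDiff_radialVelocity.pow 2)))

theorem hasDerivAt_expWeight (γ : ℝ) (z : Space d × Space d) :
    HasDerivAt (fun r : ℝ => expWeight γ (z.1 + r • z.2))
      (expWeight γ z.1 * (γ * radialVelocity z)) 0 := by
  have h := ((hasDerivAt_bracket z).const_mul γ).exp
  refine h.congr_deriv ?_
  simp only [zero_smul, add_zero, expWeight]

theorem streamDeriv_modifiedWeight (γ β : ℝ) (z : Space d × Space d) :
    streamDeriv (modifiedWeight γ β) z = expWeight γ z.1 *
      (γ * radialVelocity z * (1 + γ * radialVelocity z - γ * β * radialVelocity z ^ 2) +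
        (γ - 2 * γ * β * radialVelocity z) *
          ((‖z.2‖ ^ 2 - radialVelocity z ^ 2) * (bracket z.1)⁻¹)) := by
  apply streamDeriv_eq_of_hasDerivAt
    (differentiable_of_contDiff_infty (contDiff_modifiedWeight γ β))
  have hA := hasDerivAt_radialVelocity z
  have h := (hasDerivAt_expWeight γ z).mul
    (((hA.const_mul γ).const_add 1).sub ((hA.pow 2).const_mul (γ * β)))
  refine h.congr_deriv ?_
  simp only [zero_smul, add_zero, Pi.pow_apply, Pi.sub_apply]
  push_cast
  ring

/-- Here y is the stream derivative of a = x·v/⟨x⟩. Since ⟨x⟩⁻¹ has stream derivative −a⟨x⟩⁻², that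
of y is −3ay⟨x⟩⁻¹. -/
theorem streamDeriv_streamDeriv_modifiedWeight (γ β : ℝ) (z : Space d × Space d) :
    ∃ y : ℝ, y = (‖z.2‖ ^ 2 - radialVelocity z ^ 2) * (bracket z.1)⁻¹ ∧
    streamDeriv (streamDeriv (modifiedWeight γ β)) z = expWeight γ z.1 *
      (γ * radialVelocity z *
        (γ * radialVelocity z * (1 + γ * radialVelocity z - γ * β * radialVelocity z ^ 2) +
          (γ - 2 * γ * β * radialVelocity z) * y) +
        (γ * y * (1 + γ * radialVelocity z - γ * β * radialVelocity z ^ 2) +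
          γ * radialVelocity z * (γ * y - 2 * γ * β * radialVelocity z * y) -
          2 * γ * β * y * y - 3 * (γ - 2 * γ * β * radialVelocity z) * radialVelocity z * y *
            (bracket z.1)⁻¹)) := by
  refine ⟨_, rfl, ?_⟩
  apply streamDeriv_eq_of_hasDerivAt (differentiable_of_contDiff_infty
    (contDiff_streamDeriv (contDiff_modifiedWeight γ β)))
  have hfun : (fun r => freeFlow r (streamDeriv (modifiedWeight γ β)) z) = fun r => _ :=
    funext fun r => streamDeriv_modifiedWeight γ β (z.1 + r • z.2, z.2)
  rw [hfun]
  have hA := hasDerivAt_radialVelocity z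
  have hu := (hasDerivAt_bracket z).inv (bracket_pos _).ne'
  have h := (hasDerivAt_expWeight γ z).mul
    (((hA.const_mul γ).mul (((hA.const_mul γ).const_add 1).sub ((hA.pow 2).const_mul (γ * β)))).add
      (((hA.const_mul (2 * γ * β)).const_sub γ).mul (((hA.pow 2).const_sub (‖z.2‖ ^ 2)).mul hu)))
  refine h.congr_deriv ?_
  simp only [zero_smul, add_zero, Pi.pow_apply, Pi.sub_apply, Pi.mul_apply, Pi.add_apply,
    Pi.inv_apply]
  push_cast
  ring

end RunTumble

namespace RunTumble

variable {d : ℕ} {χ V₀ γ : ℝ}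

/-! ### Bounds for the modified weight and its stream derivatives. -/

theorem abs_radialVelocity_le_of_mem {z : Space d × Space d} (hz : z.2 ∈ velocities d V₀) :
    |radialVelocity z| ≤ V₀ :=
  (abs_radialVelocity_le z).trans (mem_ball_zero_iff.1 hz).le

/-- The weight and its stream derivatives are e^{γ⟨x⟩} times polynomials in three quantities that
range over a compact box, so no estimate has to be made by hand. -/
theorem exists_bound_radial (G : ℝ × ℝ × ℝ → ℝ) (hG : Continuous G) :
    ∃ c, 0 ≤ c ∧ ∀ z : Space d × Space d, z.2 ∈ velocities d V₀ →
      |expWeight γ z.1 * G (radialVelocity z, (bracket z.1)⁻¹, ‖z.2‖ ^ 2)| ≤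
        c * expWeight γ z.1 := by
  obtain ⟨c, hc⟩ := ((isCompact_Icc (a := -V₀) (b := V₀)).prod
    ((isCompact_Icc (a := (0 : ℝ)) (b := 1)).prod
      (isCompact_Icc (a := (0 : ℝ)) (b := V₀ ^ 2)))).exists_bound_of_continuousOn hG.continuousOn
  refine ⟨max c 0, le_max_right _ _, fun z hz => ?_⟩
  have hv : ‖z.2‖ ≤ V₀ := (mem_ball_zero_iff.1 hz).le
  have h1 := hc (radialVelocity z, (bracket z.1)⁻¹, ‖z.2‖ ^ 2)
    ⟨abs_le.1 (abs_radialVelocity_le_of_mem hz),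
      ⟨inv_nonneg.2 (bracket_pos _).le, inv_le_one_of_one_le₀ (one_le_bracket _)⟩,
      ⟨sq_nonneg _, pow_le_pow_left₀ (norm_nonneg _) hv 2⟩⟩
  rw [abs_mul, abs_of_pos (expWeight_pos γ z.1), mul_comm]
  exact mul_le_mul_of_nonneg_right (h1.trans (le_max_left _ _)) (expWeight_pos γ z.1).le

theorem exists_isStreamBounded_modifiedWeight (V₀ γ β : ℝ) :
    ∃ c, IsStreamBounded V₀ γ c (modifiedWeight γ β : Space d × Space d → ℝ) ∧
      IsStreamBounded V₀ γ c (streamDeriv (modifiedWeight γ β : Space d × Space d → ℝ)) := by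
  obtain ⟨c₀, hc₀, h₀⟩ := exists_bound_radial (d := d) (V₀ := V₀) (γ := γ)
    (fun w => 1 + γ * w.1 - γ * β * w.1 ^ 2) (by fun_prop)
  obtain ⟨c₁, hc₁, h₁⟩ := exists_bound_radial (d := d) (V₀ := V₀) (γ := γ)
    (fun w => γ * w.1 * (1 + γ * w.1 - γ * β * w.1 ^ 2) +
        (γ - 2 * γ * β * w.1) * ((w.2.2 - w.1 ^ 2) * w.2.1)) (by fun_prop)
  obtain ⟨c₂, hc₂, h₂⟩ := exists_bound_radial (d := d) (V₀ := V₀) (γ := γ)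
    (fun w => γ * w.1 * (γ * w.1 * (1 + γ * w.1 - γ * β * w.1 ^ 2) +
          (γ - 2 * γ * β * w.1) * ((w.2.2 - w.1 ^ 2) * w.2.1)) +
        (γ * ((w.2.2 - w.1 ^ 2) * w.2.1) * (1 + γ * w.1 - γ * β * w.1 ^ 2) +
          γ * w.1 * (γ * ((w.2.2 - w.1 ^ 2) * w.2.1) -
            2 * γ * β * w.1 * ((w.2.2 - w.1 ^ 2) * w.2.1)) -
          2 * γ * β * ((w.2.2 - w.1 ^ 2) * w.2.1) * ((w.2.2 - w.1 ^ 2) * w.2.1) -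
          3 * (γ - 2 * γ * β * w.1) * w.1 * ((w.2.2 - w.1 ^ 2) * w.2.1) * w.2.1)) (by fun_prop)
  have hmono : ∀ {k : ℝ} (x : Space d), k ≤ c₀ + c₁ + c₂ →
      k * expWeight γ x ≤ (c₀ + c₁ + c₂) * expWeight γ x := fun x hk =>
    mul_le_mul_of_nonneg_right hk (expWeight_pos γ x).le
  have b₁ : ∀ z : Space d × Space d, z.2 ∈ velocities d V₀ →
      |streamDeriv (modifiedWeight γ β) z| ≤ (c₀ + c₁ + c₂) * expWeight γ z.1 := fun z hz => by
    rw [streamDeriv_modifiedWeight]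
    exact (h₁ z hz).trans (hmono _ (by linarith))
  refine ⟨c₀ + c₁ + c₂, ⟨contDiff_modifiedWeight γ β, by positivity, fun z hz =>
    (h₀ z hz).trans (hmono _ (by linarith)), b₁⟩,
    ⟨contDiff_streamDeriv (contDiff_modifiedWeight γ β), by positivity, b₁, fun z hz => ?_⟩⟩
  obtain ⟨y, hy, h⟩ := streamDeriv_streamDeriv_modifiedWeight γ β z
  rw [h, hy]
  exact (h₂ z hz).trans (hmono _ (by linarith))

/-! ### The Lyapunov inequality -/

theorem setIntegral_modifiedWeight {β κ : ℝ} (hV : volume (velocities d V₀) = 1)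
    (hκ : ∀ x : Space d, ∫ v in velocities d V₀, inner ℝ x v ^ 2 = κ * ‖x‖ ^ 2) (x : Space d) :
    ∫ v in velocities d V₀, modifiedWeight γ β (x, v) =
      expWeight γ x * (1 - γ * β * κ * (1 - (bracket x)⁻¹ ^ 2)) := by
  have i0 : IntegrableOn (fun _ : Space d => expWeight γ x) (velocities d V₀) :=
    integrableOn_const (by simp [hV])
  have i1 : IntegrableOn (fun v : Space d => inner ℝ x v) (velocities d V₀) :=
    integrableOn_velocities (φ := fun z => inner ℝ z.1 z.2) (by fun_prop) x
  have i2 : IntegrableOn (fun v : Space d => inner ℝ x v ^ 2) (velocities d V₀) :=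
    integrableOn_velocities (φ := fun z => inner ℝ z.1 z.2 ^ 2) (by fun_prop) x
  have hb := (bracket_pos x).ne'
  have h : ∀ v : Space d, modifiedWeight γ β (x, v) = expWeight γ x +
      expWeight γ x * γ * (bracket x)⁻¹ * inner ℝ x v -
      expWeight γ x * γ * β * (bracket x)⁻¹ ^ 2 * inner ℝ x v ^ 2 := by
    intro v
    rw [modifiedWeight, radialVelocity]
    ring
  simp only [h]
  rw [integral_sub (f := fun v => expWeight γ x +
      expWeight γ x * γ * (bracket x)⁻¹ * inner ℝ x v) (i0.add (i1.const_mul _)) (i2.const_mul _),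
    integral_add i0 (i1.const_mul _), integral_const_mul, integral_const_mul,
    setIntegral_inner_velocities, hκ, setIntegral_const]
  have h2 : ‖x‖ ^ 2 = bracket x ^ 2 - 1 := by linarith [bracket_sq x]
  rw [h2]
  simp only [Measure.real, hV, ENNReal.toReal_one, one_smul]
  field_simp
  ring

theorem sign_inner_mul_radialVelocity (z : Space d × Space d) :
    Real.sign (inner ℝ z.1 z.2) * radialVelocity z = |radialVelocity z| := by
  have hb := bracket_pos z.1
  rw [radialVelocity]
  rcases lt_trichotomy (inner ℝ z.1 z.2) 0 with h | h | h
  · rw [Real.sign_of_neg h, abs_of_neg (div_neg_of_neg_of_pos h hb), neg_one_mul]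
  · simp [h]
  · rw [Real.sign_of_pos h, abs_of_pos (div_pos h hb), one_mul]

/-- The terms linear in a cancel between transport and tumbling; the sign in K turns the remainder
into −χ|a|. -/
theorem dualOperator_modifiedWeight {β κ : ℝ} (hV : volume (velocities d V₀) = 1)
    (hκ : ∀ x : Space d, ∫ v in velocities d V₀, inner ℝ x v ^ 2 = κ * ‖x‖ ^ 2)
    (z : Space d × Space d) :
    dualOperator χ V₀ (modifiedWeight γ β) z = expWeight γ z.1 * γ *
      (γ * radialVelocity z ^ 2 * (1 - β * radialVelocity z) +
        (1 - 2 * β * radialVelocity z) *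
          ((‖z.2‖ ^ 2 - radialVelocity z ^ 2) * (bracket z.1)⁻¹) -
        χ * |radialVelocity z| + turningKernel χ z.1 z.2 * β * radialVelocity z ^ 2 -
        turningKernel χ z.1 z.2 * β * κ * (1 - (bracket z.1)⁻¹ ^ 2)) := by
  rw [dualOperator_eq, streamDeriv_modifiedWeight,
    tumble_eq hV (contDiff_modifiedWeight γ β).continuous, setIntegral_modifiedWeight hV hκ,
    ← sign_inner_mul_radialVelocity, modifiedWeight, turningKernel]
  ring

/-- For small `γ` the modified weight is comparable to `exp (γ ⟨x⟩)` and satisfies a Lyapunov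
inequality for the dual operator. -/
theorem exists_lyapunov (hd : 1 ≤ d) (hχ₀ : 0 < χ) (hχ₁ : χ < 1)
    (hV : volume (velocities d V₀) = 1) :
    ∃ γs β : ℝ, 0 < γs ∧ ∀ γ, 0 < γ → γ < γs →
      (∀ z : Space d × Space d, z.2 ∈ velocities d V₀ →
        1 / 2 * expWeight γ z.1 ≤ modifiedWeight γ β z ∧
          modifiedWeight γ β z ≤ 3 / 2 * expWeight γ z.1) ∧
      ∃ α B : ℝ, 0 < α ∧ 0 ≤ B ∧ ∀ z : Space d × Space d, z.2 ∈ velocities d V₀ →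
        dualOperator χ V₀ (modifiedWeight γ β) z ≤ B - α * modifiedWeight γ β z := by
  have hV₀ := pos_of_volume_velocities hV
  obtain ⟨κ, hκ0, hκ⟩ := exists_setIntegral_inner_sq hd hV₀
  -- This β makes Kβa² ≤ 2βV₀|a| = χ|a|, so the favourable term absorbs the cost of the quadratic
  -- correction. The gain that survives is k = β(1 − χ)κ.
  obtain ⟨β, hβ⟩ : ∃ β, β = χ / (2 * V₀) := ⟨_, rfl⟩
  have hβ0 : 0 < β := by rw [hβ]; positivity
  have hβV : β * V₀ = χ / 2 := by rw [hβ]; field_simp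
  obtain ⟨k, hk⟩ : ∃ k, k = β * (1 - χ) * κ := ⟨_, rfl⟩
  have hk0 : 0 < k := by
    rw [hk]
    have : 0 < 1 - χ := by linarith
    positivity
  have hweight : ∀ z : Space d × Space d, z.2 ∈ velocities d V₀ →
      |β * radialVelocity z| ≤ 1 / 2 := fun z hz => by
    rw [abs_mul, abs_of_pos hβ0]
    have := mul_le_mul_of_nonneg_left (abs_radialVelocity_le_of_mem hz) hβ0.le
    linarith
  -- The first bound keeps the corrections within 1/2, hence comparability of the weights; the
  -- second makes γa²(1 − βa) at most k/4.
  refine ⟨min (1 / (4 * V₀)) (k / (8 * V₀ ^ 2)), β, by positivity, fun γ hγ hγs => ?_⟩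
  have hγ1 : γ * V₀ ≤ 1 / 4 := by
    have := mul_le_mul_of_nonneg_right (hγs.le.trans (min_le_left _ _)) hV₀.le
    refine this.trans_eq ?_
    field_simp
  have hγ2 : γ * (2 * V₀ ^ 2) ≤ k / 4 := by
    have := mul_le_mul_of_nonneg_right (hγs.le.trans (min_le_right _ _))
      (show 0 ≤ 2 * V₀ ^ 2 by positivity)
    refine this.trans_eq ?_
    field_simp
    norm_num
  have hcomp : ∀ z : Space d × Space d, z.2 ∈ velocities d V₀ →
      1 / 2 * expWeight γ z.1 ≤ modifiedWeight γ β z ∧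
        modifiedWeight γ β z ≤ 3 / 2 * expWeight γ z.1 := by
    intro z hz
    have h1 := hweight z hz
    have h2 := abs_radialVelocity_le_of_mem hz
    have h3 : |γ * radialVelocity z * (1 - β * radialVelocity z)| ≤ 1 / 2 := by
      rw [abs_mul, abs_mul, abs_of_pos hγ]
      have h4 : |1 - β * radialVelocity z| ≤ 2 := by
        rw [abs_le] at h1 ⊢
        constructor <;> linarith
      calc γ * |radialVelocity z| * |1 - β * radialVelocity z| ≤ γ * V₀ * 2 := by gcongr
        _ ≤ 1 / 2 := by linarith
    have h5 : modifiedWeight γ β z =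
        (1 + γ * radialVelocity z * (1 - β * radialVelocity z)) * expWeight γ z.1 := by
      rw [modifiedWeight]
      ring
    have h6 := expWeight_pos γ z.1
    rw [abs_le] at h3
    rw [h5]
    exact ⟨mul_le_mul_of_nonneg_right (by linarith) h6.le,
      mul_le_mul_of_nonneg_right (by linarith) h6.le⟩
  refine ⟨hcomp, ?_⟩
  -- C₃ collects the coefficients of ⟨x⟩⁻¹: 2V₀² from the derivative of a, and k from bounding 1 −
  -- ⟨x⟩⁻² below by 1 − ⟨x⟩⁻¹.
  obtain ⟨C₃, hC₃⟩ : ∃ C₃, C₃ = 2 * V₀ ^ 2 + k := ⟨_, rfl⟩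
  have hC₃0 : 0 < C₃ := by rw [hC₃]; positivity
  refine ⟨γ * k / 4, γ * C₃ * Real.exp (γ * (4 * C₃ / k)), by positivity, by positivity,
    fun z hz => ?_⟩
  rw [dualOperator_modifiedWeight hV hκ]
  have hp := (hcomp z hz).2
  have hm := expWeight_pos γ z.1
  have ha := abs_radialVelocity_le_of_mem hz
  have ha' := abs_radialVelocity_le z
  have hv : ‖z.2‖ ≤ V₀ := (mem_ball_zero_iff.1 hz).le
  have hβa := abs_le.1 (hweight z hz)
  have hb1 := one_le_bracket z.1
  have hu0 : 0 < (bracket z.1)⁻¹ := inv_pos.2 (bracket_pos _)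
  have hu1 : (bracket z.1)⁻¹ ≤ 1 := inv_le_one_of_one_le₀ hb1
  have hK2 := (turningKernel_bounds hχ₀ hχ₁ z.1 z.2).2
  have hK1 : 1 - χ ≤ turningKernel χ z.1 z.2 := by
    unfold turningKernel
    rcases Real.sign_apply_eq (inner ℝ z.1 z.2) with h | h | h <;> rw [h] <;> linarith
  set a := radialVelocity z
  set u := (bracket z.1)⁻¹ with hu
  set K := turningKernel χ z.1 z.2
  have hasq : a ^ 2 = |a| ^ 2 := (sq_abs a).symm
  have t1 : γ * a ^ 2 * (1 - β * a) ≤ k / 4 := by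
    have h1 : a ^ 2 ≤ V₀ ^ 2 := by rw [hasq]; gcongr
    calc γ * a ^ 2 * (1 - β * a) ≤ γ * V₀ ^ 2 * 2 := by
          gcongr
          linarith
          linarith
      _ ≤ k / 4 := by linarith
  have t2 : (1 - 2 * β * a) * ((‖z.2‖ ^ 2 - a ^ 2) * u) ≤ 2 * V₀ ^ 2 * u := by
    have h1 : 0 ≤ ‖z.2‖ ^ 2 - a ^ 2 := by
      rw [hasq, sub_nonneg]
      gcongr
    have h2 : ‖z.2‖ ^ 2 - a ^ 2 ≤ V₀ ^ 2 := by
      have : ‖z.2‖ ^ 2 ≤ V₀ ^ 2 := by gcongr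
      linarith [sq_nonneg a]
    calc (1 - 2 * β * a) * ((‖z.2‖ ^ 2 - a ^ 2) * u) ≤ 2 * (V₀ ^ 2 * u) := by
          gcongr
          linarith
      _ = 2 * V₀ ^ 2 * u := by ring
  have t3 : K * β * a ^ 2 ≤ χ * |a| := by
    have h1 : β * a ^ 2 ≤ χ / 2 * |a| := by
      rw [hasq, ← hβV]
      have := mul_le_mul_of_nonneg_left ha (mul_nonneg hβ0.le (abs_nonneg a))
      linarith
    have h2 := mul_le_mul_of_nonneg_right hK2 (show 0 ≤ β * a ^ 2 by positivity)
    linarith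
  have t4 : k - k * u ≤ K * β * κ * (1 - u ^ 2) := by
    have h1 : 0 ≤ 1 - u := by linarith
    calc k - k * u = (1 - χ) * β * κ * (1 - u) := by rw [hk]; ring
      _ ≤ K * β * κ * (1 - u ^ 2) := by
        have hK0 : 0 ≤ K := by linarith
        gcongr
        rw [sq]
        exact mul_le_of_le_one_left hu0.le hu1
  -- If C₃/⟨x⟩ exceeds k/4 then ⟨x⟩ < 4C₃/k, so the bad region is bounded and the constant B covers
  -- it.
  have t5 : expWeight γ z.1 * γ * (C₃ * u - k / 4) ≤ γ * C₃ * Real.exp (γ * (4 * C₃ / k)) := by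
    have hE := Real.exp_pos (γ * (4 * C₃ / k))
    rcases le_or_gt (C₃ * u) (k / 4) with h | h
    · have h1 : expWeight γ z.1 * γ * (C₃ * u - k / 4) ≤ 0 :=
        mul_nonpos_of_nonneg_of_nonpos (by positivity) (by linarith)
      have h2 : 0 ≤ γ * C₃ * Real.exp (γ * (4 * C₃ / k)) := by positivity
      linarith
    · have hbu : bracket z.1 ≤ 4 * C₃ / k := by
        rw [le_div_iff₀ hk0]
        have h1 := mul_lt_mul_of_pos_right h (bracket_pos z.1)
        rw [mul_assoc, hu, inv_mul_cancel₀ (bracket_pos z.1).ne'] at h1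
        linarith
      have h1 : expWeight γ z.1 ≤ Real.exp (γ * (4 * C₃ / k)) :=
        Real.exp_le_exp.2 (mul_le_mul_of_nonneg_left hbu hγ.le)
      have h2 : C₃ * u - k / 4 ≤ C₃ := by
        linarith [mul_le_of_le_one_right hC₃0.le hu1]
      calc expWeight γ z.1 * γ * (C₃ * u - k / 4) ≤ expWeight γ z.1 * γ * C₃ := by gcongr
        _ ≤ Real.exp (γ * (4 * C₃ / k)) * γ * C₃ := by gcongr
        _ = _ := by ring
  have t6 : expWeight γ z.1 * γ *
      (γ * a ^ 2 * (1 - β * a) + (1 - 2 * β * a) * ((‖z.2‖ ^ 2 - a ^ 2) * u) - χ * |a| +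
        K * β * a ^ 2 - K * β * κ * (1 - u ^ 2)) ≤
      expWeight γ z.1 * γ * (C₃ * u - 3 * k / 4) := by
    apply mul_le_mul_of_nonneg_left _ (by positivity)
    rw [hC₃]
    linarith
  have t7 : γ * k / 4 * modifiedWeight γ β z ≤ γ * k / 4 * (3 / 2 * expWeight γ z.1) :=
    mul_le_mul_of_nonneg_left hp (by positivity)
  have t8 : 0 ≤ expWeight γ z.1 * γ * k := by positivity
  linarith

end RunTumble

namespace RunTumble

variable {d : ℕ} {χ V₀ γ : ℝ}

/-! ### The initial datum -/

/-- The initial datum enters the definition only through the weak equation; at t = 0 it gives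
equality against all test functions, and duality upgrades this to almost everywhere. -/
theorem IsWeakSolution.ae_eq_initial {f₀ : Space d × Space d → ℝ} {f : ℝ → Space d × Space d → ℝ}
    (hf : IsWeakSolution χ V₀ γ f₀ f) (hγ : 0 ≤ γ) (hf₀ : MemL1Weight V₀ γ f₀) :
    f 0 =ᵐ[phaseMeasure d V₀] f₀ := by
  have i1 : ∀ {g}, MemL1Weight V₀ γ g → Integrable g (phaseMeasure d V₀) := fun hg => by
    simpa using hg.integrable_mul_of_bounded hγ (ψ := fun _ => 1) (c := 1)
      aestronglyMeasurable_const (by simp)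
  have hi := (i1 (hf.mem 0 le_rfl)).sub (i1 hf₀)
  have h0 : ∫ z, |f 0 z - f₀ z| * 1 ∂(phaseMeasure d V₀) ≤ 0 := by
    refine integral_abs_mul_le_of_forall_isTestFunction (g := fun z => f 0 z - f₀ z)
      (by simp only [mul_one]; exact hi) contDiff_const (fun _ _ => zero_le_one) fun φ hφ hφ1 => ?_
    obtain ⟨k, -, hk⟩ := hφ.exists_bound
    have hm := hφ.smooth.continuous.aestronglyMeasurable (μ := phaseMeasure d V₀)
    simp only [sub_mul]
    rw [integral_sub ((hf.mem 0 le_rfl).integrable_mul_of_bounded hγ hm hk)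
      (hf₀.integrable_mul_of_bounded hγ hm hk), hf.weak_eq φ hφ 0 le_rfl]
    simp
  simp only [mul_one] at h0
  have h1 := (integral_eq_zero_iff_of_nonneg (fun z => abs_nonneg _) hi.abs).1
    (le_antisymm h0 (integral_nonneg fun z => abs_nonneg _))
  filter_upwards [h1] with z hz
  exact sub_eq_zero.1 (abs_eq_zero.1 hz)

/-- Boundedness of the semigroup follows from the estimate in an equivalent norm. -/
theorem normL1Weight_le_of_max {g g₀ mt : Space d × Space d → ℝ} {C : ℝ} (hγ : 0 ≤ γ) (hC : 0 ≤ C)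
    (hg : MemL1Weight V₀ γ g) (hg₀ : MemL1Weight V₀ γ g₀) (hmt : Measurable mt)
    (hmt1 : ∀ z, z.2 ∈ velocities d V₀ →
      1 / 2 * expWeight γ z.1 ≤ mt z ∧ mt z ≤ 3 / 2 * expWeight γ z.1)
    (h : ∫ z, |g z| * mt z ∂(phaseMeasure d V₀) ≤
      max (C * ∫ z, |g₀ z| ∂(phaseMeasure d V₀)) (∫ z, |g₀ z| * mt z ∂(phaseMeasure d V₀))) :
    normL1Weight V₀ γ g ≤ (2 * C + 3) * normL1Weight V₀ γ g₀ := by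
  have hb : ∀ z : Space d × Space d, z.2 ∈ velocities d V₀ →
      |mt z| ≤ 3 / 2 * expWeight γ z.1 := fun z hz => by
    have := hmt1 z hz
    rw [abs_of_nonneg (by linarith [expWeight_pos γ z.1])]
    exact this.2
  have h1 : 1 / 2 * normL1Weight V₀ γ g ≤ ∫ z, |g z| * mt z ∂(phaseMeasure d V₀) := by
    rw [normL1Weight, ← integral_const_mul]
    refine integral_mono_ae (hg.integrable_abs_mul.const_mul _)
      (hg.abs.integrable_mul hmt.aestronglyMeasurable hb) ?_
    filter_upwards [ae_mem_velocities V₀] with z hz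
    have := mul_le_mul_of_nonneg_left (hmt1 z hz).1 (abs_nonneg (g z))
    linarith
  have h2 : ∫ z, |g₀ z| * mt z ∂(phaseMeasure d V₀) ≤ 3 / 2 * normL1Weight V₀ γ g₀ := by
    have := hg₀.abs.abs_integral_mul_le hb
    rw [normL1Weight_abs] at this
    exact (le_abs_self _).trans this
  have h3 : ∫ z, |g₀ z| ∂(phaseMeasure d V₀) ≤ 1 * normL1Weight V₀ γ g₀ := by
    have := hg₀.abs.abs_integral_mul_le (ψ := fun _ => 1) (c := 1) fun z _ => by
      rw [abs_one, one_mul]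
      exact one_le_expWeight hγ z.1
    rw [normL1Weight_abs] at this
    simpa using (le_abs_self _).trans this
  -- The lower comparison 1/2 costs a factor 2, and 2 max(C, 3/2) ≤ 2C + 3.
  have hn := normL1Weight_nonneg V₀ γ g₀
  have h4 := mul_le_mul_of_nonneg_left h3 hC
  have h5 := mul_nonneg hC hn
  rcases max_cases (C * ∫ z, |g₀ z| ∂(phaseMeasure d V₀))
    (∫ z, |g₀ z| * mt z ∂(phaseMeasure d V₀)) with ⟨e, -⟩ | ⟨e, -⟩ <;> rw [e] at h <;> linarith

end RunTumble

/-! ### Conclusion: the weighted estimate and boundedness of the semigroup. -/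

theorem lemma2p2 (d : ℕ) (hd : 1 ≤ d) (χ : ℝ) (hχ₀ : 0 < χ) (hχ₁ : χ < 1)
    (V₀ : ℝ) (hV₀ : volume (RunTumble.velocities d V₀) = 1) :
    ∃ γs : ℝ, 0 < γs ∧ ∀ γ : ℝ, 0 < γ → γ < γs →
      (∃ mt : RunTumble.Space d × RunTumble.Space d → ℝ, Measurable mt ∧
        (∃ δ : ℝ, 0 < δ ∧ δ < 1 ∧ ∀ x : RunTumble.Space d, ∀ v ∈ RunTumble.velocities d V₀,
          (1 - δ) * RunTumble.expWeight γ x ≤ mt (x, v) ∧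
            mt (x, v) ≤ (1 + δ) * RunTumble.expWeight γ x) ∧
        ∃ C : ℝ, 0 < C ∧
          ∀ (f₀ : RunTumble.Space d × RunTumble.Space d → ℝ)
            (f : ℝ → RunTumble.Space d × RunTumble.Space d → ℝ),
            RunTumble.MemL1Weight V₀ γ f₀ → RunTumble.IsWeakSolution χ V₀ γ f₀ f →
            ∀ t : ℝ, 0 ≤ t →
              Integrable (fun z => |f t z| * mt z) (RunTumble.phaseMeasure d V₀) ∧
              ∫ z, |f t z| * mt z ∂(RunTumble.phaseMeasure d V₀) ≤
                max (C * ∫ z, |f₀ z| ∂(RunTumble.phaseMeasure d V₀))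
                  (∫ z, |f₀ z| * mt z ∂(RunTumble.phaseMeasure d V₀))) ∧
      ∃ M : ℝ, 0 < M ∧
        ∀ f₀ : RunTumble.Space d × RunTumble.Space d → ℝ, RunTumble.MemL1Weight V₀ γ f₀ →
          ∀ t : ℝ, 0 ≤ t →
            RunTumble.MemL1Weight V₀ γ (RunTumble.solutionSemigroup χ V₀ γ t f₀) ∧
            RunTumble.normL1Weight V₀ γ (RunTumble.solutionSemigroup χ V₀ γ t f₀) ≤
              M * RunTumble.normL1Weight V₀ γ f₀ := by
  obtain ⟨γs, β, hγs, hmain⟩ := RunTumble.exists_lyapunov hd hχ₀ hχ₁ hV₀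
  refine ⟨γs, hγs, fun γ hγ hγlt => ?_⟩
  obtain ⟨hcomp, α, B, hα, hB, hL⟩ := hmain γ hγ hγlt
  obtain ⟨c, hp, hDp⟩ := RunTumble.exists_isStreamBounded_modifiedWeight (d := d) V₀ γ β
  have hmeas : Measurable (RunTumble.modifiedWeight γ β : RunTumble.Space d × RunTumble.Space d → ℝ) :=
    hp.smooth.continuous.measurable
  -- B may vanish; adding 1 makes the constant strictly positive.
  have hC : 0 < B / α + 1 := by positivity
  have hest : ∀ (f₀ : RunTumble.Space d × RunTumble.Space d → ℝ)
      (f : ℝ → RunTumble.Space d × RunTumble.Space d → ℝ),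
      RunTumble.MemL1Weight V₀ γ f₀ → RunTumble.IsWeakSolution χ V₀ γ f₀ f → ∀ t : ℝ, 0 ≤ t →
        ∫ z, |f t z| * RunTumble.modifiedWeight γ β z ∂(RunTumble.phaseMeasure d V₀) ≤
          max ((B / α + 1) * ∫ z, |f₀ z| ∂(RunTumble.phaseMeasure d V₀))
            (∫ z, |f₀ z| * RunTumble.modifiedWeight γ β z ∂(RunTumble.phaseMeasure d V₀)) := by
    intro f₀ f hf₀ hf t ht
    -- The local bound holds on half-open intervals, so t + 1 is used to include time t.
    obtain ⟨M, hM⟩ := hf.locallyBounded (t + 1) (by linarith)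
    have key := (hf.isWeakFlow hγ.le hV₀ hχ₀ hχ₁).integral_abs_mul_le_max hV₀ hχ₀ hχ₁ hγ.le hp hDp
      (fun z hz => (mul_nonneg (by norm_num) (RunTumble.expWeight_pos γ z.1).le).trans
        (hcomp z hz).1) hα hB hL ht
      (fun r hr => hM r ⟨hr.1, by linarith [hr.2]⟩)
    have h0 := hf.ae_eq_initial hγ.le hf₀
    have e1 : ∫ z, |f 0 z| ∂(RunTumble.phaseMeasure d V₀) =
        ∫ z, |f₀ z| ∂(RunTumble.phaseMeasure d V₀) :=
      integral_congr_ae (h0.mono fun z hz => by simp only [hz])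
    have e2 : ∫ z, |f 0 z| * RunTumble.modifiedWeight γ β z ∂(RunTumble.phaseMeasure d V₀) =
        ∫ z, |f₀ z| * RunTumble.modifiedWeight γ β z ∂(RunTumble.phaseMeasure d V₀) :=
      integral_congr_ae (h0.mono fun z hz => by simp only [hz])
    rw [e1, e2] at key
    have hN : 0 ≤ ∫ z, |f₀ z| ∂(RunTumble.phaseMeasure d V₀) :=
      integral_nonneg fun z => abs_nonneg _
    exact key.trans (max_le_max_right _ (by linarith))
  refine ⟨⟨RunTumble.modifiedWeight γ β, hmeas, ⟨1 / 2, by norm_num, by norm_num, fun x v hv => ?_⟩,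
    B / α + 1, hC, fun f₀ f hf₀ hf t ht => ⟨?_, hest f₀ f hf₀ hf t ht⟩⟩,
    2 * (B / α + 1) + 3, by positivity, fun f₀ hf₀ t ht => ?_⟩
  · have := hcomp (x, v) hv
    constructor <;> linarith [this.1, this.2]
  · exact (hf.mem t ht).abs.integrable_mul hmeas.aestronglyMeasurable hp.bound
  · unfold RunTumble.solutionSemigroup
    split_ifs with h
    · have hf := h.choose_spec
      exact ⟨hf.mem t ht, RunTumble.normL1Weight_le_of_max hγ.le hC.le (hf.mem t ht) hf₀ hmeas hcomp
        (hest f₀ _ hf₀ hf t ht)⟩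
    -- If no solution exists the semigroup takes the default value 0, for which the bound is
    -- trivial.
    · have h1 : RunTumble.MemL1Weight V₀ γ (0 : RunTumble.Space d × RunTumble.Space d → ℝ) :=
        ⟨aestronglyMeasurable_const, by simp⟩
      refine ⟨h1, ?_⟩
      have h2 : RunTumble.normL1Weight V₀ γ (0 : RunTumble.Space d × RunTumble.Space d → ℝ) = 0 := by
        simp [RunTumble.normL1Weight]
      rw [h2]
      exact mul_nonneg (by positivity) (RunTumble.normL1Weight_nonneg _ _ _)
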